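/- **Setting.** Let $X\subset\mathbb R^d$ be a finite set, $n=|X|$. A $k$-clustering of $X$ is a partition $A=(A_1,\dots,A_k)$ into nonempty clusters, with $n_r=|A_r|$ and means $m(A_r)$; its cost is $\phi(m(A),A)=\sum_r\sum_{x\in A_r}\|x-m(A_r)\|^2$. For $k$ centroids $C=(c_1,\dots,c_k)$ put $\phi(C)=\sum_{x\in X}\min_r\|x-c_r\|^2$. Let $A^{opt}$ be a $k$-clustering of minimal cost $\phi^{opt}$, with $C^{opt}=(c_r^{opt})_r$, $c_r^{opt}=m(A_r^{opt})$, $n_r=|A_r^{opt}|$, and let $\Delta(C,C^{opt})=\min_{\pi}\sum_r n_r\|c_{\pi(r)}-c^{opt}_r\|^2$, where $\pi$ ranges over the permutations of $[k]$. For $r\ne s$ the margin is $\Delta_{rs}=\min_{x\in A_r^{opt}\cup A_s^{opt}}\big|\|\bar x-c_r^{opt}\|-\|\bar x-c_s^{opt}\|\big|$, where $\bar x$ is the projection of $x$ onto the line through $c_r^{opt},c_s^{opt}$. Put $p_{\min}=\min_r n_r/n$ and $w_{\min}=\min_r w_r$ with $w_r=\dfrac{\frac1{n_r}\sum_{x\in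 A^{opt}_r}\|x-c^{opt}_r\|^2}{\max_{x\in A^{opt}_r}\|x-c_r^{opt}\|^2}$ (and $w_r=1$ if all points of $A_r^{opt}$ coincide with $c_r^{opt}$). **Assumptions.** There are $\alpha\in(0,1)$ and reals $f=f(\alpha)$, $\gamma$ such that - (B1) $\|c_r^{opt}-c_s^{opt}\|\ge f\sqrt{\phi^{opt}}\big(\tfrac1{\sqrt{n_r}}+\tfrac1{\sqrt{n_s}}\big)$ for all $r\ne s$, and $f>\max\{64^2,\frac{5\alpha+5}{256\alpha},\max_{r\neq s}\frac{n_r}{n_s}\}$; - (B2) $\Delta_{rs}\ge\gamma\|c_r^{opt}-c_s^{opt}\|$ for all $r\ne s$, and $\gamma>8\sqrt2/\sqrt f$; - (B3) $p_{\min}\ge\frac{\gamma}{16^2f}+\sqrt\alpha$. **Algorithm.** *Buckshot seeding*: draw $m_o$ points from $X$ uniformly with replacement, run Single-Linkage on the (indexed) sample until $k$ components are left, and let $C^0$ consist of the means of the sample points in the components. *Mini-batch $k$-means*: at iteration $t\ge1$ draw $m$ points from $X$ uniformly with replacement, assign each to a nearest centroid of $C^{t-1}$, and for each $r$ that receives at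 least one point set $c^t_r=(1-\eta^t)c_r^{t-1}+\eta^t\hat c_r^t$, where $\hat c_r^t$ is the mean (with multiplicity) of the points assigned to $r$; the other centroids do not move. All draws are independent, ties are broken by arbitrary fixed rules, $\eta^t=\frac{c'}{t+t_o}$, and $\phi^t=\phi(C^t)$. **Theorem.** Let $m>1$, $c'>\dfrac{1}{2[1-\sqrt\alpha-(1-\sqrt\alpha)^m]}$ and $\rho(m)=1-\big[1-(p_{\min}-\frac{\gamma}{16^2f})\big]^m$. There is a constant $K>0$, depending only on $X,A^{opt},\alpha,f,\gamma,m,c'$, such that the following holds for all $\xi\in(0,1)$, all $\delta\in(0,1/e]$, all integers $m_o\ge 0$ and all real $t_o$. Suppose that $$f\ge5\sqrt{\tfrac1{2w_{\min}}\ln\Big(\tfrac{2}{\xi p_{\min}}\ln\tfrac{2k}{\xi}\Big)},\qquad \frac{\ln\frac{2k}\xi}{p_{\min}}<m_o<\frac\xi2\exp\Big\{2\big(\tfrac f4-1\big)^2w_{\min}^2\Big\},$$ $$t_o\ge K\left[\frac{(c')^2}{\rho(m)^2\,(2c'(\rho(m)-\sqrt\alpha)-1)}\ln\frac1\delta\right]^{\frac{2}{2c'(\rho(m)-\sqrt\alpha)-1}}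 .$$ Then there is a constant $M$, not depending on $t$, such that for every $t\ge1$ there is an event $G_t$, determined by the trajectory $(C^0,C^1,\dots)$, with $$\Pr\{G_t\}\ge(1-\delta)(1-\xi)\quad\text{and}\quad E[\phi^t\mid G_t]-\phi^{opt}\le E[\Delta(C^t,C^{opt})\mid G_t]\le\frac Mt .$$ -/

import Mathlib

open MeasureTheory ProbabilityTheory Finset
open scoped ENNReal

namespace KMeans

noncomputable section

/-- The ambient Euclidean space. -/
abbrev Pt (d : ℕ) : Type := EuclideanSpace ℝ (Fin d)

/-! ### Clusterings, centroids and the objective -/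

/-- The mean `m(Y)` of a finite point set. -/
def mean {d : ℕ} (Y : Finset (Pt d)) : Pt d := (#Y : ℝ)⁻¹ • ∑ y ∈ Y, y

/-- The centroids `m(A)` induced by a clustering. -/
def means {d k : ℕ} (A : Fin k → Finset (Pt d)) : Fin k → Pt d := fun r => mean (A r)

/-- `A` is a `k`-clustering of `X`: a partition of `X` into `k` nonempty labelled clusters. -/
def IsClustering {d k : ℕ} (X : Finset (Pt d)) (A : Fin k → Finset (Pt d)) : Prop :=
  (∀ r, (A r).Nonempty) ∧ (∀ r s, r ≠ s → Disjoint (A r) (A s)) ∧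
    ∀ x, x ∈ X ↔ ∃ r, x ∈ A r

/-- The `k`-means cost `φ(C, A)` of centroids `C` with respect to a clustering `A`. -/
def costWith {d k : ℕ} (C : Fin k → Pt d) (A : Fin k → Finset (Pt d)) : ℝ :=
  ∑ r, ∑ x ∈ A r, ‖x - C r‖ ^ 2

/-- The `k`-means cost `φ(C)` on `X`: every point is charged to a closest centroid. -/
def cost {d k : ℕ} (X : Finset (Pt d)) (C : Fin k → Pt d) : ℝ :=
  ∑ x ∈ X, ⨅ r, ‖x - C r‖ ^ 2

/-- The cost `φ(m(A), A)` of a clustering; it is `φ^opt` when `A` is optimal. -/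
def clusterCost {d k : ℕ} (A : Fin k → Finset (Pt d)) : ℝ := costWith (means A) A

/-- `A` is an optimal `k`-means clustering of `X`. -/
def IsOptimalClustering {d k : ℕ} (X : Finset (Pt d)) (A : Fin k → Finset (Pt d)) : Prop :=
  IsClustering X A ∧
    ∀ A' : Fin k → Finset (Pt d), IsClustering X A' → clusterCost A ≤ clusterCost A'

/-- The distance `Δ(C', m(A)) = min_π ∑_r n_r ‖c'_{π(r)} - m(A_r)‖²`, where `n_r = |A_r|`. -/
def centroidDist {d k : ℕ} (C' : Fin k → Pt d) (A : Fin k → Finset (Pt d)) : ℝ :=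
  ⨅ π : Equiv.Perm (Fin k), ∑ r, (#(A r) : ℝ) * ‖C' (π r) - means A r‖ ^ 2

/-! ### Parameters of a clustering and the geometric assumptions -/

/-- `p_min = min_r n_r / n`. -/
def pMin {d k : ℕ} (X : Finset (Pt d)) (A : Fin k → Finset (Pt d)) : ℝ :=
  ⨅ r, (#(A r) : ℝ) / (#X : ℝ)

open Classical in
/-- The ratio of the average to the maximal squared distance of the points of `Y` to their mean,
with value `1` if all points of `Y` coincide with the mean. -/
def spreadRatio {d : ℕ} (Y : Finset (Pt d)) : ℝ :=
  if ∀ x ∈ Y, x = mean Y then 1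
  else ((∑ x ∈ Y, ‖x - mean Y‖ ^ 2) / (#Y : ℝ)) / (⨆ x : Y, ‖(x : Pt d) - mean Y‖ ^ 2)

/-- `w_min`, the smallest spread ratio of a cluster. -/
def wMin {d k : ℕ} (A : Fin k → Finset (Pt d)) : ℝ := ⨅ r, spreadRatio (A r)

/-- The margin `Δ_{rs}`: the minimum over `x ∈ A_r ∪ A_s` of `|‖x̄ - c_r‖ - ‖x̄ - c_s‖|`, where
`x̄` is the orthogonal projection of `x` onto the line joining the two cluster means. -/
def margin {d k : ℕ} (A : Fin k → Finset (Pt d)) (r s : Fin k) : ℝ :=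
  ⨅ x : {x : Pt d // x ∈ A r ∨ x ∈ A s},
    |‖(EuclideanGeometry.orthogonalProjection (line[ℝ, means A r, means A s]) x.1 : Pt d)
          - means A r‖
      - ‖(EuclideanGeometry.orthogonalProjection (line[ℝ, means A r, means A s]) x.1 : Pt d)
          - means A s‖|

/-- (B1) Mean separation, with separation factor `f = f(α)`. -/
structure MeanSeparation {d k : ℕ} (A : Fin k → Finset (Pt d)) (α f : ℝ) : Prop where
  alpha_pos : 0 < α
  alpha_lt_one : α < 1
  lt_f : (64 : ℝ) ^ 2 < f
  alpha_lt_f : (5 * α + 5) / (256 * α) < f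
  ratio_lt_f : ∀ r s, s ≠ r → (#(A r) : ℝ) / (#(A s) : ℝ) < f
  separated : ∀ r s, s ≠ r →
    f * √(clusterCost A) * (1 / √(#(A r) : ℝ) + 1 / √(#(A s) : ℝ)) ≤ ‖means A r - means A s‖

/-- (B2) Existence of a margin. -/
structure HasMargin {d k : ℕ} (A : Fin k → Finset (Pt d)) (f γ : ℝ) : Prop where
  lt_gamma : 8 * √2 / √f < γ
  margin_le : ∀ r s, s ≠ r → γ * ‖means A r - means A s‖ ≤ margin A r s

/-- (B3) Cluster balance. -/
def ClusterBalance {d k : ℕ} (X : Finset (Pt d)) (A : Fin k → Finset (Pt d))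
    (α f γ : ℝ) : Prop :=
  γ / (16 ^ 2 * f) + √α ≤ pMin X A

/-- `ρ(m) = 1 - (1 - (p_min - γ / (16² f)))^m`. -/
def rho {d k : ℕ} (X : Finset (Pt d)) (A : Fin k → Finset (Pt d)) (f γ : ℝ) (m : ℕ) : ℝ :=
  1 - (1 - (pMin X A - γ / (16 ^ 2 * f))) ^ m

/-! ### Buckshot seeding -/

/-- The partitions of the index set that Single-Linkage can reach on the points `ν`: start with
singletons and repeatedly merge two components containing a closest pair of points that lie in
different components (ties are broken arbitrarily). -/
inductive SingleLinkage {d n : ℕ} (ν : Fin n → Pt d) : Finset (Finset (Fin n)) → Prop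
  | init : SingleLinkage ν (univ.image fun i => {i})
  | merge (Q : Finset (Finset (Fin n))) (S T : Finset (Fin n)) (i j : Fin n)
      (hQ : SingleLinkage ν Q) (hS : S ∈ Q) (hT : T ∈ Q) (hST : S ≠ T)
      (hi : i ∈ S) (hj : j ∈ T)
      (hmin : ∀ S' ∈ Q, ∀ T' ∈ Q, S' ≠ T' → ∀ i' ∈ S', ∀ j' ∈ T',
        dist (ν i) (ν j) ≤ dist (ν i') (ν j')) :
      SingleLinkage ν (insert (S ∪ T) ((Q.erase S).erase T))

/-- `C` is an output of Buckshot seeding on the sample `ν`: Single-Linkage is run until `k`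
components `S_1, …, S_k` are left, and `c_r` is the mean of the sample points in `S_r`. -/
def IsBuckshotSeed {d n k : ℕ} (ν : Fin n → Pt d) (C : Fin k → Pt d) : Prop :=
  ∃ S : Fin k → Finset (Fin n), Function.Injective S ∧ SingleLinkage ν (univ.image S) ∧
    ∀ r, C r = (#(S r) : ℝ)⁻¹ • ∑ i ∈ S r, ν i

/-! ### Mini-batch `k`-means -/

/-- `I` assigns to centroids `C` and a point `x` the index of a centroid of `C` closest to `x`
(any rule for breaking ties). -/
def IsNearestRule {d k : ℕ} (I : (Fin k → Pt d) → Pt d → Fin k) : Prop :=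
  ∀ (C : Fin k → Pt d) (x : Pt d) (r : Fin k), ‖x - C (I C x)‖ ≤ ‖x - C r‖

/-- One iteration on the mini-batch `s` with learning rate `η`. -/
def step {d k m : ℕ} (I : (Fin k → Pt d) → Pt d → Fin k) (η : ℝ)
    (C : Fin k → Pt d) (s : Fin m → Pt d) : Fin k → Pt d := fun r =>
  let S : Finset (Fin m) := univ.filter fun j => I C (s j) = r
  if S.Nonempty then (1 - η) • C r + η • ((#S : ℝ)⁻¹ • ∑ j ∈ S, s j) else C r

/-- The iterates `C^0, C^1, …` with learning rate `η^t = c' / (t + t_o)`; the mini-batch used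
at iteration `t + 1` is `s t`. -/
def iterates {d k m : ℕ} (I : (Fin k → Pt d) → Pt d → Fin k) (c' tₒ : ℝ)
    (C₀ : Fin k → Pt d) (s : ℕ → Fin m → Pt d) : ℕ → Fin k → Pt d
  | 0 => C₀
  | t + 1 => step I (c' / (((t + 1 : ℕ) : ℝ) + tₒ)) (iterates I c' tₒ C₀ s t) (s t)

/-- The random points `Z i` are drawn from `X` independently and uniformly at random. -/
structure IsUniformSampling {d : ℕ} {X : Finset (Pt d)} {ι Ω : Type*} [MeasurableSpace Ω]
    (P : Measure Ω) (Z : ι → Ω → X) : Prop where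
  measurable : ∀ i, Measurable (Z i)
  indep : iIndepFun Z P
  uniform : ∀ i (x : X), P {ω | Z i ω = x} = (#X : ℝ≥0∞)⁻¹

/-- The trajectory `(C^0, C^1, …)` of mini-batch `k`-means with Buckshot seeding, as a function of
the outcome: the draws `Z (inl i)`, `i ∈ [m_o]`, are the seeding sample and
`Z (inr (t, j))`, `j ∈ [m]`, form the mini-batch of iteration `t + 1`. -/
def trajectory {d k m mₒ : ℕ} {X : Finset (Pt d)} {Ω : Type*}
    (seed : (Fin mₒ → Pt d) → Fin k → Pt d) (I : (Fin k → Pt d) → Pt d → Fin k) (c' tₒ : ℝ)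
    (Z : Fin mₒ ⊕ ℕ × Fin m → Ω → X) (ω : Ω) : ℕ → Fin k → Pt d :=
  iterates I c' tₒ (seed fun i => (Z (Sum.inl i) ω : Pt d))
    fun t j => (Z (Sum.inr (t, j)) ω : Pt d)

end

end KMeans

namespace KMeans

open scoped BigOperators

/-! ### Means and costs -/

/-! The proof has three independent ingredients, joined by a quadratic potential.

Geometry. Let Φ be a positive bound for the optimal cost and `b = f / 2 * Φ`. If `centroidDist C A ≤
b`, a point that `C` assigns to the wrong cluster lies further from its own mean than the two means
lie from each other. Since the squared distances to the own means sum to at most Φ, such points are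
rare: each Voronoi cell keeps a fraction `1 - 1 / f ^ 2` of its cluster, and the cell means deviate
from the cluster means by a small multiple of `√(centroidDist C A)` (`WellSeparated.cell_bounds`). A
mini-batch hits a cell with probability at least `1 - (1 - √α) ^ m`, and conditionally on a hit its
mean is unbiased for the cell mean. One step with rate η therefore multiplies the distance by at
most `1 - 2 * η * a` in expectation, with `a = 1 - √α - (1 - √α) ^ m`, up to `O(η ^ 2)`
(`WellSeparated.exists_step_bound`).

Seeding. If the sample hits every cluster and contains only central points, equal labels are closer
than different ones, so Single-Linkage recovers the labels and the seed lies within `b / 2`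
(`WellSeparated.seed_bound`). Both requirements hold with probability at least `1 - 3 * ξ / 4`:
Markov's inequality controls noncentral points, and their mere existence forces `wMin A ≤ 4 / f`,
hence `mₒ < 4 * ξ`.

Confinement. The potential `max (Δ - b / 2) 0 ^ 2` vanishes at a good seed, exceeds `b ^ 2 / 4` on
leaving the `b`-neighbourhood, and grows by only `O(η ^ 2)` per step in expectation. As the squared
rates sum to at most `c' ^ 2 / tₒ`, the exit probability is `O(1 / tₒ)` uniformly in time
(`ContractsNear.real_confined_zero_sub_le`). The bounds on `mₒ` keep ξ above a constant of the data,
so a fixed lower bound on `tₒ` pushes this below `ξ / 4`.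

The event `G_t` is confinement up to time `t`. These events decrease in `t`, so the integrals of Δ
over them obey the contraction recursion, whose solution is `O(1 / t)` because `2 * c' * a > 1`
(`ContractsNear.setIntegral_le`); dividing by `P.real G` gives the conditional bound. -/

theorem card_smul_mean {d : ℕ} {Y : Finset (Pt d)} (hY : Y.Nonempty) :
    (#Y : ℝ) • mean Y = ∑ y ∈ Y, y := by
  have : (#Y : ℝ) ≠ 0 := by exact_mod_cast hY.card_pos.ne'
  rw [mean, smul_smul, mul_inv_cancel₀ this, one_smul]

theorem sum_sub_eq_card_smul {d : ℕ} {Y : Finset (Pt d)} (hY : Y.Nonempty) (c : Pt d) :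
    ∑ y ∈ Y, (y - c) = (#Y : ℝ) • (mean Y - c) := by
  rw [sum_sub_distrib, smul_sub, card_smul_mean hY, sum_const, ← Nat.cast_smul_eq_nsmul ℝ]

theorem sum_sub_mean {d : ℕ} {Y : Finset (Pt d)} (hY : Y.Nonempty) :
    ∑ y ∈ Y, (y - mean Y) = 0 := by
  rw [sum_sub_eq_card_smul hY, sub_self, smul_zero]

theorem sum_norm_sub_sq {d : ℕ} {Y : Finset (Pt d)} (hY : Y.Nonempty) (c : Pt d) :
    ∑ y ∈ Y, ‖y - c‖ ^ 2 = ∑ y ∈ Y, ‖y - mean Y‖ ^ 2 + #Y * ‖c - mean Y‖ ^ 2 := by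
  have h : ∀ y ∈ Y, ‖y - c‖ ^ 2 =
      ‖y - mean Y‖ ^ 2 - 2 * inner ℝ (y - mean Y) (c - mean Y) + ‖c - mean Y‖ ^ 2 := by
    intro y _
    rw [← norm_sub_sq_real, sub_sub_sub_cancel_right]
  rw [sum_congr rfl h, sum_add_distrib, sum_sub_distrib, ← mul_sum, ← sum_inner,
    sum_sub_mean hY, inner_zero_left, sum_const, nsmul_eq_mul]
  ring

namespace IsClustering

variable {d k : ℕ} {X : Finset (Pt d)} {A : Fin k → Finset (Pt d)}

theorem exists_label (h : IsClustering X A) (hk : 0 < k) :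
    ∃ l : Pt d → Fin k, ∀ x ∈ X, ∀ r, x ∈ A r ↔ l x = r := by
  classical
  have hl : ∀ x, ∃ r : Fin k, x ∈ X → x ∈ A r := fun x => by
    by_cases hx : x ∈ X
    · obtain ⟨r, hr⟩ := (h.2.2 x).1 hx
      exact ⟨r, fun _ => hr⟩
    · exact ⟨⟨0, hk⟩, fun hx' => absurd hx' hx⟩
  choose l hl using hl
  refine ⟨l, fun x hx r => ⟨fun hr => ?_, fun hr => hr ▸ hl x hx⟩⟩
  by_contra hne
  exact disjoint_left.1 (h.2.1 _ _ hne) (hl x hx) hr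

theorem subset (h : IsClustering X A) (r : Fin k) : A r ⊆ X :=
  fun x hx => (h.2.2 x).2 ⟨r, hx⟩

theorem card_pos (h : IsClustering X A) (r : Fin k) : (0 : ℝ) < #(A r) := by
  exact_mod_cast (h.1 r).card_pos

theorem sum_eq {M : Type*} [AddCommMonoid M] (h : IsClustering X A) (F : Pt d → M) :
    ∑ x ∈ X, F x = ∑ r, ∑ x ∈ A r, F x := by
  classical
  have hX : X = univ.biUnion A := by
    ext x
    simp [h.2.2 x]
  rw [hX, sum_biUnion]
  exact fun r _ s _ hrs => h.2.1 r s hrs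

theorem card_eq (h : IsClustering X A) : (#X : ℝ) = ∑ r, (#(A r) : ℝ) := by
  have := h.sum_eq (fun _ => (1 : ℝ))
  simpa using this

theorem costWith_eq (h : IsClustering X A) (C : Fin k → Pt d) :
    costWith C A = clusterCost A + ∑ r, (#(A r) : ℝ) * ‖C r - means A r‖ ^ 2 := by
  simp only [clusterCost, costWith, ← sum_add_distrib]
  exact sum_congr rfl fun r _ => sum_norm_sub_sq (h.1 r) _

theorem clusterCost_le_costWith (h : IsClustering X A) (C : Fin k → Pt d) :
    clusterCost A ≤ costWith C A := by
  rw [h.costWith_eq C]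
  exact le_add_of_nonneg_right (sum_nonneg fun r _ => by positivity)

theorem cost_le_costWith (h : IsClustering X A) (C : Fin k → Pt d) (π : Equiv.Perm (Fin k)) :
    cost X C ≤ costWith (fun r => C (π r)) A := by
  rw [cost, h.sum_eq, costWith]
  exact sum_le_sum fun r _ => sum_le_sum fun x _ => ciInf_le (Set.finite_range _).bddBelow (π r)

end IsClustering

/-! ### The distance between centroid tuples -/

section centroidDist

variable {d k : ℕ} {X : Finset (Pt d)} {A : Fin k → Finset (Pt d)}

theorem centroidDist_le (C : Fin k → Pt d) (A : Fin k → Finset (Pt d))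
    (π : Equiv.Perm (Fin k)) :
    centroidDist C A ≤ ∑ r, (#(A r) : ℝ) * ‖C (π r) - means A r‖ ^ 2 :=
  ciInf_le (Set.finite_range _).bddBelow π

theorem exists_centroidDist_eq (C : Fin k → Pt d) (A : Fin k → Finset (Pt d)) :
    ∃ π : Equiv.Perm (Fin k),
      ∑ r, (#(A r) : ℝ) * ‖C (π r) - means A r‖ ^ 2 = centroidDist C A :=
  exists_eq_ciInf_of_finite

theorem centroidDist_nonneg (C : Fin k → Pt d) (A : Fin k → Finset (Pt d)) :
    0 ≤ centroidDist C A :=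
  Real.iInf_nonneg fun _ => sum_nonneg fun _ _ => by positivity

theorem measurable_centroidDist (A : Fin k → Finset (Pt d)) :
    Measurable fun C : Fin k → Pt d => centroidDist C A := by
  unfold centroidDist
  exact Measurable.iInf fun π => by fun_prop

theorem IsClustering.cost_sub_clusterCost_le (h : IsClustering X A) (C : Fin k → Pt d) :
    cost X C - clusterCost A ≤ centroidDist C A := by
  obtain ⟨π, hπ⟩ := exists_centroidDist_eq C A
  have := h.cost_le_costWith C π
  rw [h.costWith_eq] at this
  linarith

end centroidDist

/-! ### Optimal clusterings -/

theorem clusterCost_nonneg {d k : ℕ} (A : Fin k → Finset (Pt d)) : 0 ≤ clusterCost A := by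
  unfold clusterCost costWith
  exact sum_nonneg fun _ _ => sum_nonneg fun _ _ => by positivity

/-- Moving `x` to the other cluster while keeping the centroids changes the cost by the difference
of the two squared distances, and recomputing the means can only lower it further. Optimality makes
that difference nonnegative. -/
theorem IsOptimalClustering.norm_sub_le {d k : ℕ} {X : Finset (Pt d)}
    {A : Fin k → Finset (Pt d)} (hA : IsOptimalClustering X A) {r : Fin k} (s : Fin k)
    {x : Pt d} (hx : x ∈ A r) : ‖x - means A r‖ ≤ ‖x - means A s‖ := by
  classical
  rcases eq_or_ne s r with rfl | hsr
  · exact le_rfl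
  obtain ⟨hc, hopt⟩ := hA
  have hxq : ∀ q, q ≠ r → x ∉ A q := fun q hq hxq =>
    disjoint_left.1 (hc.2.1 q r hq) hxq hx
  -- Removing `x` from a singleton would leave an empty cluster, but then `x` is its own mean.
  by_cases h1 : (A r).erase x = ∅
  · have hAr : A r = {x} := by
      rcases (erase_eq_empty_iff _ _).1 h1 with h | h
      · rw [h] at hx
        simp at hx
      · exact h
    have : means A r = x := by simp [means, mean, hAr]
    simp [this]
  set A' : Fin k → Finset (Pt d) := fun q => if q = s then insert x (A s) else (A q).erase x
    with hA'
  have hcl : IsClustering X A' := by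
    refine ⟨fun q => ?_, fun q p hqp => ?_, fun y => ?_⟩
    · simp only [hA']
      split_ifs with hq
      · exact insert_nonempty _ _
      · rcases eq_or_ne q r with rfl | hqr
        · exact nonempty_iff_ne_empty.2 h1
        · rw [erase_eq_of_notMem (hxq q hqr)]
          exact hc.1 q
    · rw [disjoint_left]
      intro y hyq hyp
      by_cases hyx : y = x
      · subst hyx
        simp only [hA'] at hyq hyp
        split_ifs at hyq hyp <;> simp_all
      · have aux : ∀ q, y ∈ A' q → y ∈ A q := fun q hy => by
          simp only [hA'] at hy
          split_ifs at hy with hq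
          · subst hq
            simpa [hyx] using hy
          · exact mem_of_mem_erase hy
        exact disjoint_left.1 (hc.2.1 q p hqp) (aux q hyq) (aux p hyp)
    · rw [hc.2.2 y]
      by_cases hyx : y = x
      · subst hyx
        exact ⟨fun _ => ⟨s, by simp [hA']⟩, fun _ => ⟨r, hx⟩⟩
      · refine exists_congr fun q => ?_
        simp only [hA']
        split_ifs with hq
        · subst hq
          simp [hyx]
        · simp [hyx]
  have hsum : ∀ q, ∑ y ∈ A' q, ‖y - means A q‖ ^ 2 = ∑ y ∈ A q, ‖y - means A q‖ ^ 2 +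
      ((if q = s then ‖x - means A q‖ ^ 2 else 0) -
        (if q = r then ‖x - means A q‖ ^ 2 else 0)) := by
    intro q
    simp only [hA']
    by_cases hq : q = s
    · subst hq
      rw [if_pos rfl, if_pos rfl, if_neg hsr, sum_insert (hxq q hsr)]
      ring
    · rw [if_neg hq, if_neg hq]
      by_cases hqr : q = r
      · subst hqr
        rw [if_pos rfl, ← add_sum_erase _ _ hx]
        ring
      · rw [if_neg hqr, erase_eq_of_notMem (hxq q hqr)]
        ring
  have h2 : costWith (means A) A' =
      clusterCost A + (‖x - means A s‖ ^ 2 - ‖x - means A r‖ ^ 2) := by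
    rw [costWith, sum_congr rfl fun q _ => hsum q, sum_add_distrib, sum_sub_distrib]
    simp [clusterCost, costWith]
  have h3 := (hopt A' hcl).trans (hcl.clusterCost_le_costWith (means A))
  rw [h2] at h3
  exact (sq_le_sq₀ (norm_nonneg _) (norm_nonneg _)).1 (by linarith)

/-- The margin, as a gap between squared distances. -/
theorem IsOptimalClustering.sq_gap {d k : ℕ} {X : Finset (Pt d)}
    {A : Fin k → Finset (Pt d)} (hA : IsOptimalClustering X A) {f γ : ℝ}
    (hB2 : HasMargin A f γ) {r s : Fin k} (hrs : s ≠ r) {x : Pt d} (hx : x ∈ A r) :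
    γ * ‖means A r - means A s‖ ^ 2 ≤ ‖x - means A s‖ ^ 2 - ‖x - means A r‖ ^ 2 := by
  have h1 := (hB2.margin_le r s hrs).trans
    (ciInf_le ⟨0, by rintro _ ⟨y, rfl⟩; exact abs_nonneg _⟩
      (⟨x, Or.inl hx⟩ : {x : Pt d // x ∈ A r ∨ x ∈ A s}))
  have h2 := hA.norm_sub_le s hx
  -- By Pythagoras the gap of squared distances is the same for `x` and for its projection `y`.
  -- There it factors as difference times sum: the margin bounds the difference, with its sign
  -- supplied by optimality, and the triangle inequality bounds the sum.
  have hr := EuclideanGeometry.dist_sq_eq_dist_orthogonalProjection_sq_add_dist_orthogonalProjection_sq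
    (s := line[ℝ, means A r, means A s]) x (left_mem_affineSpan_pair ℝ _ _)
  have hs := EuclideanGeometry.dist_sq_eq_dist_orthogonalProjection_sq_add_dist_orthogonalProjection_sq
    (s := line[ℝ, means A r, means A s]) x (right_mem_affineSpan_pair ℝ _ _)
  simp only at h1
  set y : Pt d := (EuclideanGeometry.orthogonalProjection
    (line[ℝ, means A r, means A s]) x : Pt d)
  rw [dist_comm (means A r), dist_eq_norm, dist_comm (means A r), dist_eq_norm y] at hr
  rw [dist_comm (means A s), dist_eq_norm, dist_comm (means A s), dist_eq_norm y] at hs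
  have h3 : ‖x - means A r‖ ^ 2 ≤ ‖x - means A s‖ ^ 2 := by gcongr
  have h4 : ‖y - means A r‖ ≤ ‖y - means A s‖ :=
    (sq_le_sq₀ (norm_nonneg _) (norm_nonneg _)).1 (by nlinarith)
  rw [abs_sub_comm, abs_of_nonneg (by linarith)] at h1
  have h5 : ‖means A r - means A s‖ ≤ ‖y - means A r‖ + ‖y - means A s‖ := by
    have := _root_.norm_sub_le (y - means A s) (y - means A r)
    rw [sub_sub_sub_cancel_left] at this
    linarith
  have h6 : γ * ‖means A r - means A s‖ * ‖means A r - means A s‖ ≤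
      (‖y - means A s‖ - ‖y - means A r‖) * (‖y - means A r‖ + ‖y - means A s‖) := by
    gcongr
  nlinarith

/-! ### Voronoi cells of centroids close to a well-separated clustering -/

/-- Cluster separation at scale `Φ`, which bounds the cost and is positive even if the cost
vanishes. -/
structure WellSeparated {d k : ℕ} (A : Fin k → Finset (Pt d)) (f γ Φ : ℝ) : Prop where
  lt_f : (64 : ℝ) ^ 2 < f
  lt_gamma : 8 * √2 / √f < γ
  scale_pos : 0 < Φ
  cost_le : clusterCost A ≤ Φ
  separated : ∀ r s, s ≠ r →
    f * √Φ * (1 / √(#(A r) : ℝ) + 1 / √(#(A s) : ℝ)) ≤ ‖means A r - means A s‖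
  gap : ∀ r s, s ≠ r → ∀ x ∈ A r,
    γ * ‖means A r - means A s‖ ^ 2 ≤ ‖x - means A s‖ ^ 2 - ‖x - means A r‖ ^ 2

theorem lt_mul_sqrt {f γ : ℝ} (hf : (64 : ℝ) ^ 2 < f) (hγ : 8 * √2 / √f < γ) :
    8 * √2 < γ * √f :=
  (div_lt_iff₀ (Real.sqrt_pos.2 (by linarith))).1 hγ

theorem sixtyFour_lt_sqrt {f : ℝ} (hf : (64 : ℝ) ^ 2 < f) : 64 < √f :=
  Real.lt_sqrt_of_sq_lt hf

/-- Lower bounds on the distance `δ` from a point to its own mean if the point is closer to a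
perturbed foreign centroid. -/
theorem misassigned_bounds {f γ Φ V a b L δ u v : ℝ} (hf : (64 : ℝ) ^ 2 < f)
    (hγ : 8 * √2 / √f < γ) (hΦ : 0 < Φ) (hV : 0 ≤ V) (hVΦ : V ^ 2 ≤ f / 2 * Φ)
    (ha : 0 < a) (hb : 0 < b) (hL : f * √Φ * (a + b) ≤ L) (hδ : 0 ≤ δ) (hu0 : 0 ≤ u)
    (hu : u ≤ V * a) (hv : v ≤ V * b)
    (h : γ * L ^ 2 ≤ 2 * δ * (u + v) + 2 * L * v + u ^ 2) :
    2 / 5 * γ * L ^ 2 ≤ δ * V * (a + b) ∧ L ≤ δ := by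
  have hg := lt_mul_sqrt hf hγ
  have h64 := sixtyFour_lt_sqrt hf
  have h2 : √2 ^ 2 = 2 := Real.sq_sqrt (by norm_num)
  have h2' : 1 ≤ √2 := Real.one_le_sqrt.2 (by norm_num)
  have hff : √f ^ 2 = f := Real.sq_sqrt (by linarith)
  have hΦΦ : √Φ ^ 2 = Φ := Real.sq_sqrt hΦ.le
  have hΦ0 : 0 < √Φ := Real.sqrt_pos.2 hΦ
  have hγ0 : 0 < γ := lt_of_le_of_lt (by positivity) hγ
  have hL0 : 0 < L := lt_of_lt_of_le (by positivity) hL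
  have hVs : V * √2 ≤ √f * √Φ := by
    refine (sq_le_sq₀ (by positivity) (by positivity)).1 ?_
    rw [mul_pow, mul_pow, h2, hff, hΦΦ]
    linarith
  -- The threshold `8 * √2 / √f` for γ, together with `V * √2 ≤ √f * √Φ`, yields exactly the factor
  -- 16.
  have hVh : V * (a + b) ≤ γ * L / 16 := by
    have e1 : γ * (f * √Φ * (a + b)) ≤ γ * L := by gcongr
    have e2 : 8 * √2 * (√f * √Φ * (a + b)) ≤ γ * √f * (√f * √Φ * (a + b)) := by gcongr
    have e3 : V * √2 * (√2 * (a + b)) ≤ √f * √Φ * (√2 * (a + b)) := by gcongr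
    have e4 : γ * √f * (√f * √Φ * (a + b)) = γ * (f * √Φ * (a + b)) := by
      linear_combination γ * √Φ * (a + b) * hff
    have e5 : V * √2 * (√2 * (a + b)) = 2 * (V * (a + b)) := by
      linear_combination V * (a + b) * h2
    linarith
  have hVL : V * (a + b) ≤ L / 64 := by
    have e1 : V * 1 * (a + b) ≤ V * √2 * (a + b) := by gcongr
    have e2 : V * √2 * (a + b) ≤ √f * √Φ * (a + b) := by gcongr
    have e3 : 64 * (√f * √Φ * (a + b)) ≤ √f * (√f * √Φ * (a + b)) := by gcongr
    have e4 : √f * (√f * √Φ * (a + b)) = f * √Φ * (a + b) := by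
      linear_combination √Φ * (a + b) * hff
    linarith
  have hvh : v ≤ V * (a + b) := hv.trans (by nlinarith)
  have huh : u ≤ V * (a + b) := hu.trans (by nlinarith)
  have e1 : 2 * L * v ≤ 2 * L * (γ * L / 16) := by
    have := hvh.trans hVh
    gcongr
  have e2 : u ^ 2 ≤ γ * L / 16 * (L / 64) := by
    rw [sq]
    gcongr
    · exact huh.trans hVh
    · exact huh.trans hVL
  have e3 : δ * (u + v) ≤ δ * (V * (a + b)) := by
    gcongr
    linarith
  have hγL : 0 < γ * L ^ 2 := by positivity
  -- The two error terms use up 1/8 and 1/1024 of `γ * L ^ 2`; half of the remainder exceeds 2/5.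
  have e4 : 2 / 5 * γ * L ^ 2 ≤ δ * V * (a + b) := by nlinarith
  refine ⟨e4, ?_⟩
  have e5 : δ * (V * (a + b)) ≤ δ * (γ * L / 16) := by gcongr
  have e6 : (γ * L) * (2 / 5 * L) ≤ (γ * L) * (δ / 16) := by nlinarith
  have := le_of_mul_le_mul_left e6 (by positivity)
  linarith

section Voronoi

variable {d k : ℕ} {X : Finset (Pt d)} {A : Fin k → Finset (Pt d)} {f γ Φ : ℝ}

/-- A misassigned point overcomes the gap between the squared distances only through the
displacement of the centroids, whose effect is proportional to its distance from its own mean; so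
that distance is large. The index `q` allows normalising by the size of the cluster that loses the
point or of the one that receives it. -/
theorem WellSeparated.misassigned (hw : WellSeparated A f γ Φ) (hA : IsClustering X A)
    {C : Fin k → Pt d} {V : ℝ} (hV : 0 ≤ V)
    (hC : ∀ r, √(#(A r) : ℝ) * ‖C r - means A r‖ ≤ V) (hVΦ : V ^ 2 ≤ f / 2 * Φ)
    {r s : Fin k} (hrs : s ≠ r) {x : Pt d} (hx : x ∈ A r) (hxs : ‖x - C s‖ ≤ ‖x - C r‖)
    {q : Fin k} (hq : q = r ∨ q = s) :
    f ^ 2 * Φ ≤ ‖x - means A r‖ ^ 2 * #(A q) ∧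
    γ * f ^ 2 * Φ ≤ 5 / 2 * V * √(#(A q) : ℝ) * ‖x - means A r‖ ∧
    ‖x - means A s‖ ≤ 2 * ‖x - means A r‖ := by
  have hn : ∀ r, 0 < √(#(A r) : ℝ) := fun r => Real.sqrt_pos.2 (hA.card_pos r)
  have hu : ∀ r, ‖C r - means A r‖ ≤ V * (1 / √(#(A r) : ℝ)) := fun r => by
    rw [mul_one_div, le_div_iff₀ (hn r), mul_comm]
    exact hC r
  -- Expand both squared distances around the true means and insert the gap; Cauchy–Schwarz bounds
  -- the cross terms.
  have key : γ * ‖means A r - means A s‖ ^ 2 ≤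
      2 * ‖x - means A r‖ * (‖C r - means A r‖ + ‖C s - means A s‖) +
        2 * ‖means A r - means A s‖ * ‖C s - means A s‖ + ‖C r - means A r‖ ^ 2 := by
    have h1 := hw.gap r s hrs x hx
    have h2 : ‖x - C s‖ ^ 2 ≤ ‖x - C r‖ ^ 2 := by gcongr
    have e : ∀ q, ‖x - C q‖ ^ 2 = ‖x - means A q‖ ^ 2 -
        2 * inner ℝ (x - means A q) (C q - means A q) + ‖C q - means A q‖ ^ 2 := fun q => by
      rw [← norm_sub_sq_real, sub_sub_sub_cancel_right]
    rw [e s, e r] at h2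
    have i1 := neg_le_of_abs_le (abs_real_inner_le_norm (x - means A r) (C r - means A r))
    have i2 := le_of_abs_le (abs_real_inner_le_norm (x - means A s) (C s - means A s))
    have i3 : ‖x - means A s‖ ≤ ‖x - means A r‖ + ‖means A r - means A s‖ := by
      simpa using norm_add_le (x - means A r) (means A r - means A s)
    have i4 : ‖x - means A s‖ * ‖C s - means A s‖ ≤
        (‖x - means A r‖ + ‖means A r - means A s‖) * ‖C s - means A s‖ := by gcongr
    nlinarith [sq_nonneg ‖C s - means A s‖]
  obtain ⟨h1, h2⟩ := misassigned_bounds hw.lt_f hw.lt_gamma hw.scale_pos hV hVΦ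
    (one_div_pos.2 (hn r)) (one_div_pos.2 (hn s)) (hw.separated r s hrs) (norm_nonneg _)
    (norm_nonneg _) (hu r) (hu s) key
  have hsep := hw.separated r s hrs
  have hf0 : 0 < f := lt_trans (by norm_num) hw.lt_f
  have hγ0 : 0 < γ := lt_of_le_of_lt (by positivity) hw.lt_gamma
  have hqq : √(#(A q) : ℝ) ^ 2 = #(A q) := Real.sq_sqrt (hA.card_pos q).le
  have hΦΦ : √Φ ^ 2 = Φ := Real.sq_sqrt hw.scale_pos.le
  have hΦ0 : 0 < √Φ := Real.sqrt_pos.2 hw.scale_pos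
  set h := 1 / √(#(A r) : ℝ) + 1 / √(#(A s) : ℝ) with hh
  have hr0 := one_div_pos.2 (hn r)
  have hs0 := one_div_pos.2 (hn s)
  have hh0 : 0 < h := by positivity
  have h1n : 1 ≤ √(#(A q) : ℝ) * h := by
    have : 1 / √(#(A q) : ℝ) ≤ h := by
      rcases hq with rfl | rfl <;> rw [hh] <;> linarith
    have := mul_le_mul_of_nonneg_left this (hn q).le
    rwa [mul_one_div_cancel (hn q).ne'] at this
  set δ := ‖x - means A r‖
  set L := ‖means A r - means A s‖
  set n := √(#(A q) : ℝ)
  have hnq : 0 < n := hn q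
  have hL : f * √Φ ≤ n * L :=
    calc f * √Φ = f * √Φ * 1 := (mul_one _).symm
      _ ≤ f * √Φ * (n * h) := by gcongr
      _ = n * (f * √Φ * h) := by ring
      _ ≤ n * L := by gcongr
  refine ⟨?_, ?_, ?_⟩
  · calc f ^ 2 * Φ = (f * √Φ) ^ 2 := by rw [mul_pow, hΦΦ]
      _ ≤ (n * δ) ^ 2 := by
        have := hL.trans (mul_le_mul_of_nonneg_left h2 hnq.le)
        gcongr
      _ = δ ^ 2 * #(A q) := by rw [mul_pow, hqq]; ring
  · have h3 : 2 / 5 * γ * (f * √Φ * h) ^ 2 ≤ δ * V * h := le_trans (by gcongr) h1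
    have h4 : h * (2 / 5 * γ * (f * √Φ) ^ 2 * h) ≤ h * (δ * V) := by nlinarith
    have h5 := le_of_mul_le_mul_left h4 hh0
    have h6 : γ * (f * √Φ) ^ 2 * 1 ≤ γ * (f * √Φ) ^ 2 * (n * h) := by gcongr
    have h7 : n * (2 / 5 * γ * (f * √Φ) ^ 2 * h) ≤ n * (δ * V) := by gcongr
    rw [mul_pow, hΦΦ] at h6 h7
    nlinarith
  · have : ‖x - means A s‖ ≤ δ + L := by
      simpa using norm_add_le (x - means A r) (means A r - means A s)
    linarith

/-- The points of `X` that the rule `I` assigns to `r`. -/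
def cell (X : Finset (Pt d)) (I : Pt d → Fin k) (r : Fin k) : Finset (Pt d) :=
  X.filter fun x => I x = r

/-- Misassigned points are charged to the cost. Each one lost by cluster `s` contributes at least `f
^ 2 * Φ / #(A s)` to a sum of squares bounded by Φ, which limits their number; the shift of the cell
mean is a sum over misassigned points alone, since the points of `A s` balance around their mean. -/
theorem WellSeparated.cell_bounds (hw : WellSeparated A f γ Φ) (hA : IsClustering X A)
    {C : Fin k → Pt d} {V : ℝ} (hV : 0 ≤ V)
    (hC : ∀ r, √(#(A r) : ℝ) * ‖C r - means A r‖ ≤ V) (hVΦ : V ^ 2 ≤ f / 2 * Φ)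
    {I : Pt d → Fin k} (hI : ∀ x r, ‖x - C (I x)‖ ≤ ‖x - C r‖) :
    (∀ r, (1 - 1 / f ^ 2) * #(A r) ≤ #(cell X I r)) ∧
    ∑ r, √(#(A r) : ℝ) * ‖mean (cell X I r) - means A r‖ ≤ 20 / (γ * f ^ 2) * V := by
  classical
  have hf0 : 0 < f := lt_trans (by norm_num) hw.lt_f
  have hγ0 : 0 < γ := lt_of_le_of_lt (by positivity) hw.lt_gamma
  have hΦ := hw.scale_pos
  rcases Nat.eq_zero_or_pos k with rfl | hk
  · exact ⟨fun r => r.elim0, by simpa using by positivity⟩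
  obtain ⟨l, hl⟩ := hA.exists_label hk
  set δ : Pt d → ℝ := fun x => ‖x - means A (l x)‖ with hδ
  have hAl : ∀ r, A r = X.filter fun x => l x = r := fun r => by
    ext x
    rw [mem_filter]
    exact ⟨fun h => ⟨hA.subset r h, (hl x (hA.subset r h) r).1 h⟩, fun h => (hl x h.1 r).2 h.2⟩
  have hX : ∑ x ∈ X, δ x ^ 2 ≤ Φ := by
    refine le_trans (le_of_eq ?_) hw.cost_le
    rw [hA.sum_eq, clusterCost, costWith]
    refine sum_congr rfl fun r _ => sum_congr rfl fun x hx => ?_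
    rw [hδ]
    simp only
    rw [(hl x (hA.subset r hx) r).1 hx]
  set out : Fin k → Finset (Pt d) := fun s => X.filter fun x => l x = s ∧ I x ≠ s with hout
  set inc : Fin k → Finset (Pt d) := fun s => X.filter fun x => I x = s ∧ l x ≠ s with hinc
  have mis : ∀ x ∈ X, ∀ s, l x ≠ I x → (s = l x ∨ s = I x) →
      f ^ 2 * Φ ≤ δ x ^ 2 * #(A s) ∧
      γ * f ^ 2 * Φ ≤ 5 / 2 * V * √(#(A s) : ℝ) * δ x ∧
      ‖x - means A (I x)‖ ≤ 2 * δ x := fun x hx s hne hs =>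
    hw.misassigned hA hV hC hVΦ (Ne.symm hne) ((hl x hx _).2 rfl) (hI x _) hs
  have houtΦ : ∀ s, ∑ x ∈ out s, δ x ^ 2 ≤ Φ := fun s =>
    (sum_le_sum_of_subset_of_nonneg (filter_subset _ _) fun _ _ _ => by positivity).trans hX
  have hcard : ∀ s, (#(A s) : ℝ) ≤ #(cell X I s) + #(out s) := fun s => by
    have : A s ⊆ cell X I s ∪ out s := fun x hx => by
      rw [hAl, mem_filter] at hx
      simp only [cell, hout, mem_union, mem_filter]
      tauto
    exact_mod_cast (card_le_card this).trans (card_union_le _ _)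
  have hcell : ∀ s, (1 - 1 / f ^ 2) * #(A s) ≤ #(cell X I s) := fun s => by
    have h1 : (#(out s) : ℝ) * (f ^ 2 * Φ) ≤ #(A s) * Φ := by
      calc (#(out s) : ℝ) * (f ^ 2 * Φ) = ∑ x ∈ out s, f ^ 2 * Φ := by
            rw [sum_const, nsmul_eq_mul]
        _ ≤ ∑ x ∈ out s, δ x ^ 2 * #(A s) := sum_le_sum fun x hx => by
            simp only [hout, mem_filter] at hx
            exact (mis x hx.1 s (by rw [hx.2.1]; exact hx.2.2.symm) (Or.inl hx.2.1.symm)).1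
        _ ≤ Φ * #(A s) := by
            rw [← sum_mul]
            gcongr
            exact houtΦ s
        _ = #(A s) * Φ := mul_comm _ _
    have h2 : (#(out s) : ℝ) * f ^ 2 ≤ #(A s) :=
      le_of_mul_le_mul_right (by linarith) hΦ
    have h3 : (#(out s) : ℝ) ≤ #(A s) / f ^ 2 := (le_div_iff₀ (by positivity)).2 h2
    have h4 : (1 - 1 / f ^ 2) * (#(A s) : ℝ) = #(A s) - #(A s) / f ^ 2 := by ring
    linarith [hcard s]
  refine ⟨hcell, ?_⟩
  have hf2 : 1 / f ^ 2 ≤ 1 / 2 := by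
    have := hw.lt_f
    exact one_div_le_one_div_of_le (by norm_num) (by nlinarith)
  have hs : ∀ s, γ * f ^ 2 * Φ * (√(#(A s) : ℝ) * ‖mean (cell X I s) - means A s‖) ≤
      10 * V * (∑ x ∈ inc s, δ x ^ 2 + ∑ x ∈ out s, δ x ^ 2) := fun s => by
    have hn := hA.card_pos s
    have hcn : (#(A s) : ℝ) / 2 ≤ #(cell X I s) := le_trans (by nlinarith) (hcell s)
    have hne : (cell X I s).Nonempty := by
      rw [← Finset.card_pos]
      exact_mod_cast lt_of_lt_of_le (half_pos hn) hcn
    have e1 : (#(cell X I s) : ℝ) • (mean (cell X I s) - means A s) =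
        ∑ x ∈ inc s, (x - means A s) - ∑ x ∈ out s, (x - means A s) := by
      have e2 := sum_sub_mean (hA.1 s)
      rw [hAl, ← sum_filter_add_sum_filter_not _ (fun x => I x = s), filter_filter,
        filter_filter, ← hAl] at e2
      rw [← sum_sub_eq_card_smul hne, cell,
        ← sum_filter_add_sum_filter_not _ (fun x => l x = s), filter_filter, filter_filter]
      have e3 : (X.filter fun x => I x = s ∧ l x = s) = X.filter fun x => l x = s ∧ I x = s :=
        filter_congr fun x _ => and_comm
      rw [e3, eq_sub_iff_add_eq, add_right_comm]
      simp only [means, hout, hinc]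
      rw [e2, zero_add]
    have h1 : #(cell X I s) * ‖mean (cell X I s) - means A s‖ ≤
        ∑ x ∈ inc s, 2 * δ x + ∑ x ∈ out s, δ x := by
      have := congrArg norm e1
      rw [norm_smul, Real.norm_natCast] at this
      rw [this]
      refine (norm_sub_le _ _).trans (add_le_add ?_ ?_)
      · refine norm_sum_le_of_le _ fun x hx => ?_
        simp only [hinc, mem_filter] at hx
        have := (mis x hx.1 s (by rw [hx.2.1]; exact hx.2.2) (Or.inr hx.2.1.symm)).2.2
        rwa [hx.2.1] at this
      · refine norm_sum_le_of_le _ fun x hx => ?_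
        simp only [hout, mem_filter] at hx
        simp only [hδ, hx.2.1]
        exact le_rfl
    -- Multiplying the lower bound on `δ x` by `δ x` trades the linear sums of the mean shift for
    -- the quadratic sums that the cost controls, with a gain of order `V`.
    have hδ2 : ∀ x ∈ X, l x ≠ I x → (s = l x ∨ s = I x) →
        γ * f ^ 2 * Φ * δ x ≤ 5 / 2 * V * √(#(A s) : ℝ) * δ x ^ 2 := fun x hx h1 h2 => by
      have := mul_le_mul_of_nonneg_right (mis x hx s h1 h2).2.1 (norm_nonneg _ : 0 ≤ δ x)
      linarith
    have h2 : γ * f ^ 2 * Φ * (∑ x ∈ inc s, 2 * δ x + ∑ x ∈ out s, δ x) ≤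
        5 * V * √(#(A s) : ℝ) * (∑ x ∈ inc s, δ x ^ 2 + ∑ x ∈ out s, δ x ^ 2) := by
      rw [mul_add, mul_add]
      refine add_le_add ?_ ?_
      · rw [mul_sum, mul_sum]
        refine sum_le_sum fun x hx => ?_
        simp only [hinc, mem_filter] at hx
        have := hδ2 x hx.1 (by rw [hx.2.1]; exact hx.2.2) (Or.inr hx.2.1.symm)
        linarith
      · rw [mul_sum, mul_sum]
        refine sum_le_sum fun x hx => ?_
        simp only [hout, mem_filter] at hx
        have := hδ2 x hx.1 (by rw [hx.2.1]; exact hx.2.2.symm) (Or.inl hx.2.1.symm)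
        have h3 : 0 ≤ 5 / 2 * V * √(#(A s) : ℝ) * δ x ^ 2 := by positivity
        linarith
    have hsq : √(#(A s) : ℝ) * √(#(A s) : ℝ) = #(A s) := Real.mul_self_sqrt hn.le
    have hsp : 0 < √(#(A s) : ℝ) := Real.sqrt_pos.2 hn
    set E := ‖mean (cell X I s) - means A s‖ with hE
    have hE0 : 0 ≤ E := norm_nonneg _
    -- The cell contains at least half as many points as the cluster; this doubles the factor 5. The
    -- final 20 arises because the incoming and the outgoing sums, taken over all clusters, are each
    -- at most Φ.
    have h3 : √(#(A s) : ℝ) * (γ * f ^ 2 * Φ * (√(#(A s) : ℝ) * E)) ≤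
        √(#(A s) : ℝ) * (10 * V * (∑ x ∈ inc s, δ x ^ 2 + ∑ x ∈ out s, δ x ^ 2)) := by
      calc √(#(A s) : ℝ) * (γ * f ^ 2 * Φ * (√(#(A s) : ℝ) * E))
          = γ * f ^ 2 * Φ * (2 * (#(A s) / 2 * E)) := by
            linear_combination γ * f ^ 2 * Φ * E * hsq
        _ ≤ γ * f ^ 2 * Φ * (2 * (∑ x ∈ inc s, 2 * δ x + ∑ x ∈ out s, δ x)) := by
            have : (#(A s) : ℝ) / 2 * E ≤ #(cell X I s) * E := by gcongr
            have := this.trans h1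
            gcongr
        _ = 2 * (γ * f ^ 2 * Φ * (∑ x ∈ inc s, 2 * δ x + ∑ x ∈ out s, δ x)) := by ring
        _ ≤ 2 * (5 * V * √(#(A s) : ℝ) * (∑ x ∈ inc s, δ x ^ 2 + ∑ x ∈ out s, δ x ^ 2)) := by
            gcongr
        _ = _ := by ring
    exact le_of_mul_le_mul_left h3 hsp
  have hin : ∑ s, ∑ x ∈ inc s, δ x ^ 2 ≤ Φ := by
    refine le_trans ?_ hX
    rw [← sum_fiberwise X I (fun x => δ x ^ 2)]
    refine sum_le_sum fun s _ => sum_le_sum_of_subset_of_nonneg (fun x hx => ?_)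
      fun _ _ _ => by positivity
    simp only [hinc, mem_filter] at hx ⊢
    exact ⟨hx.1, hx.2.1⟩
  have hot : ∑ s, ∑ x ∈ out s, δ x ^ 2 ≤ Φ := by
    refine le_trans ?_ hX
    rw [← sum_fiberwise X l (fun x => δ x ^ 2)]
    refine sum_le_sum fun s _ => sum_le_sum_of_subset_of_nonneg (fun x hx => ?_)
      fun _ _ _ => by positivity
    simp only [hout, mem_filter] at hx ⊢
    exact ⟨hx.1, hx.2.1⟩
  have htot := sum_le_sum fun s (_ : s ∈ univ) => hs s
  rw [← mul_sum, ← mul_sum, sum_add_distrib] at htot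
  have h5 : 10 * V * (∑ s, ∑ x ∈ inc s, δ x ^ 2 + ∑ s, ∑ x ∈ out s, δ x ^ 2) ≤
      10 * V * (Φ + Φ) := by gcongr
  rw [div_mul_eq_mul_div, le_div_iff₀ (by positivity)]
  refine le_of_mul_le_mul_left (a := Φ) ?_ hΦ
  linarith

end Voronoi

/-! ### Averages over all mini-batches -/

section Batch

variable {T : Type*} [Fintype T] {m : ℕ}

/-- Exchanging the `j`-th draw with an extra independent point is an involution of batch-point
pairs: resampling one coordinate preserves the uniform distribution. -/
theorem card_smul_sum_batch {E : Type*} [AddCommMonoid E] (F : (Fin m → T) → E) (j : Fin m) :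
    Fintype.card T • ∑ s, F s = ∑ s : Fin m → T, ∑ x, F (Function.update s j x) := by
  have hinv : Function.Involutive fun p : (Fin m → T) × T =>
      (Function.update p.1 j p.2, p.1 j) := fun p => by simp
  calc Fintype.card T • ∑ s, F s = ∑ p : (Fin m → T) × T, F p.1 := by
        rw [Fintype.sum_prod_type]
        simp [smul_sum]
    _ = ∑ p : (Fin m → T) × T, F (Function.update p.1 j p.2) :=
        (Equiv.sum_comp hinv.toPerm fun p => F p.1).symm
    _ = _ := Fintype.sum_prod_type _

/-- If `g` sums to zero over `p`, so does the mean of `g` over the batch members in `p`, summed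
over all batches. -/
theorem sum_batch_mean_eq_zero {E : Type*} [AddCommGroup E] [Module ℝ E] (p : T → Prop)
    [DecidablePred p] (g : T → E) (hg : ∑ x with p x, g x = 0) :
    ∑ s : Fin m → T, (#{j | p (s j)} : ℝ)⁻¹ • ∑ j with p (s j), g (s j) = 0 := by
  classical
  rcases isEmpty_or_nonempty T with hT | hT
  · refine sum_eq_zero fun s _ => ?_
    rw [sum_eq_zero fun j _ => hT.elim (s j), smul_zero]
  have h1 : ∀ s : Fin m → T, (#{j | p (s j)} : ℝ)⁻¹ • ∑ j with p (s j), g (s j) =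
      ∑ j, if p (s j) then (#{i | p (s i)} : ℝ)⁻¹ • g (s j) else 0 := fun s => by
    rw [smul_sum, sum_filter]
  rw [sum_congr rfl fun s _ => h1 s, sum_comm]
  refine sum_eq_zero fun j _ => ?_
  have h2 := card_smul_sum_batch (fun s : Fin m → T =>
    if p (s j) then (#{i | p (s i)} : ℝ)⁻¹ • g (s j) else 0) j
  have h3 : ∀ s : Fin m → T, ∑ x, (if p (Function.update s j x j) then
      (#{i | p (Function.update s j x i)} : ℝ)⁻¹ • g (Function.update s j x j) else 0) = 0 := by
    intro s
    -- When the resampled draw lies in `p`, the number of hits no longer depends on which point it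
    -- is, so the weight leaves the sum over `x`.
    have h4 : ∀ x, (if p (Function.update s j x j) then
        (#{i | p (Function.update s j x i)} : ℝ)⁻¹ • g (Function.update s j x j) else 0) =
        (#{i | i = j ∨ p (s i)} : ℝ)⁻¹ • if p x then g x else 0 := fun x => by
      rw [Function.update_self]
      split_ifs with hx
      · congr 4
        refine filter_congr fun i _ => ?_
        by_cases hij : i = j
        · subst hij
          simp [hx]
        · simp [hij]
      · rw [smul_zero]
    rw [sum_congr rfl fun x _ => h4 x, ← smul_sum, ← sum_filter, hg, smul_zero]
  rw [sum_congr rfl fun s _ => h3 s, sum_const_zero, ← Nat.cast_smul_eq_nsmul ℝ] at h2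
  exact (smul_eq_zero.1 h2).resolve_left (by exact_mod_cast Fintype.card_ne_zero)

theorem card_batch_hit (p : T → Prop) [DecidablePred p] :
    (#{s : Fin m → T | ∃ j, p (s j)} : ℝ) =
      (Fintype.card T : ℝ) ^ m - (Fintype.card T - #{x | p x} : ℝ) ^ m := by
  classical
  have h1 := card_filter_add_card_filter_not (s := (univ : Finset (Fin m → T)))
    (fun s => ∃ j, p (s j))
  have h2 : (univ.filter fun s : Fin m → T => ¬ ∃ j, p (s j)) =
      Fintype.piFinset fun _ => univ.filter fun x => ¬ p x := by
    ext s
    simp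
  have h3 := card_filter_add_card_filter_not (s := (univ : Finset T)) p
  rw [h2, Fintype.card_piFinset_const, card_univ, Fintype.card_fun, Fintype.card_fin] at h1
  rw [card_univ] at h3
  have h4 : (#{x | ¬ p x} : ℝ) = Fintype.card T - #{x | p x} := by
    rw [← h3]
    push_cast
    ring
  rw [← h4, eq_sub_iff_add_eq]
  exact_mod_cast h1

end Batch

/-! ### One iteration -/

section Step

variable {d k m : ℕ} {X : Finset (Pt d)}

/-- The update direction of centroid `q` in a mini-batch iteration. -/
noncomputable def direction (I : Pt d → Fin k) (c : Pt d) (q : Fin k) (s : Fin m → X) : Pt d :=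
  (#{j | I (s j) = q} : ℝ)⁻¹ • ∑ j with I (s j) = q, ((s j : Pt d) - c)

theorem step_apply (I : (Fin k → Pt d) → Pt d → Fin k) (η : ℝ) (C : Fin k → Pt d)
    (s : Fin m → X) (q : Fin k) :
    step I η C (fun j => (s j : Pt d)) q = C q + η • direction (I C) (C q) q s := by
  unfold step direction
  simp only
  split_ifs with h
  · have : (#{j | I C (s j) = q} : ℝ) ≠ 0 := by exact_mod_cast h.card_pos.ne'
    rw [sum_sub_distrib, sum_const, ← Nat.cast_smul_eq_nsmul ℝ, smul_sub, smul_smul _ _ (C q),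
      inv_mul_cancel₀ this, one_smul, sub_smul, one_smul, smul_sub]
    abel
  -- Without a hit the direction is `0⁻¹ • 0 = 0`, so the additive formula also covers centroids
  -- that do not move.
  · rw [not_nonempty_iff_eq_empty] at h
    simp [h]

theorem norm_direction_le {I : Pt d → Fin k} {c : Pt d} {q : Fin k} {R : ℝ} (hR0 : 0 ≤ R)
    (hR : ∀ x ∈ X, ‖x - c‖ ≤ R) (s : Fin m → X) : ‖direction I c q s‖ ≤ R := by
  unfold direction
  rw [norm_smul, norm_inv, Real.norm_natCast]
  have h1 : ‖∑ j with I (s j) = q, ((s j : Pt d) - c)‖ ≤ #{j | I (s j) = q} * R := by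
    refine (norm_sum_le_of_le _ fun j _ => hR _ (s j).2).trans ?_
    rw [sum_const, nsmul_eq_mul]
  rcases eq_or_ne (#{j | I (s j) = q} : ℝ) 0 with h | h
  · rw [h]
    simpa using hR0
  · rw [inv_mul_le_iff₀ (by positivity)]
    exact h1

/-- Split the direction at the cell mean μ: the centred part averages to zero over all batches, and
the rest is `μ - c` on every batch that hits the cell. -/
theorem sum_direction {I : Pt d → Fin k} {c : Pt d} {q : Fin k} (hne : (cell X I q).Nonempty) :
    ∑ s : Fin m → X, direction I c q s =
      ((#X : ℝ) ^ m - (#X - #(cell X I q) : ℝ) ^ m) • (mean (cell X I q) - c) := by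
  classical
  set μ := mean (cell X I q)
  have hs : ∀ s : Fin m → X, direction I c q s =
      (#{j | I (s j) = q} : ℝ)⁻¹ • ∑ j with I (s j) = q, ((s j : Pt d) - μ) +
        if ∃ j, I (s j) = q then μ - c else 0 := fun s => by
    have e : ∀ j, (s j : Pt d) - c = ((s j : Pt d) - μ) + (μ - c) := fun j => by abel
    rw [direction, sum_congr rfl fun j _ => e j, sum_add_distrib, smul_add, sum_const,
      ← Nat.cast_smul_eq_nsmul ℝ, smul_smul]
    congr 1
    split_ifs with h
    · have : (#{j | I (s j) = q} : ℝ) ≠ 0 := by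
        obtain ⟨j, hj⟩ := h
        exact_mod_cast (card_pos.2 ⟨j, by simpa using hj⟩).ne'
      rw [inv_mul_cancel₀ this, one_smul]
    · have : (univ.filter fun j => I (s j) = q) = ∅ := by
        push Not at h
        simpa [filter_eq_empty_iff] using h
      simp [this]
  have hX : ∀ {M : Type} [AddCommMonoid M] (F : Pt d → M),
      ∑ x ∈ univ.filter (fun x : X => I x = q), F x = ∑ x ∈ cell X I q, F x := by
    intro M _ F
    rw [cell, sum_filter, sum_filter, ← sum_coe_sort X]
  have h0 : ∑ x ∈ univ.filter (fun x : X => I x = q), ((x : Pt d) - μ) = 0 := by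
    rw [hX fun x => x - μ]
    exact sum_sub_mean hne
  rw [sum_congr rfl fun s _ => hs s, sum_add_distrib,
    sum_batch_mean_eq_zero (fun x : X => I x = q) (fun x : X => (x : Pt d) - μ) h0, zero_add,
    ← sum_filter, sum_const, ← Nat.cast_smul_eq_nsmul ℝ,
    card_batch_hit (fun x : X => I x = q), Fintype.card_coe]
  congr 4
  have := hX (fun _ => (1 : ℕ))
  simpa using this

/-- The hit probability `H` is used in both directions: `H ≤ 1` for the error caused by the shifted
cell mean, `H ≥ 1 - (1 - β) ^ m` for the pull towards `o`. -/
theorem expect_direction_le {I : Pt d → Fin k} {c : Pt d} (o : Pt d) {q : Fin k} {R η β : ℝ}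
    (hβ : 0 ≤ β) (hXpos : (0 : ℝ) < #X) (hne : (cell X I q).Nonempty)
    (hfr : β ≤ #(cell X I q) / #X) (hη : 0 ≤ η) (hR0 : 0 ≤ R) (hR : ∀ x ∈ X, ‖x - c‖ ≤ R) :
    𝔼 s : Fin m → X, (2 * η * inner ℝ (c - o) (direction I c q s) +
        η ^ 2 * ‖direction I c q s‖ ^ 2) ≤
      2 * η * (‖c - o‖ * ‖mean (cell X I q) - o‖ - (1 - (1 - β) ^ m) * ‖c - o‖ ^ 2) +
        η ^ 2 * R ^ 2 := by
  have hXne : Nonempty X := by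
    have : X.Nonempty := Finset.card_pos.1 (by exact_mod_cast hXpos)
    exact this.to_subtype
  have hsum := sum_direction (m := m) (c := c) hne
  set H : ℝ := 1 - (1 - #(cell X I q) / #X) ^ m with hH
  set μ := mean (cell X I q)
  have hcX : (#(cell X I q) : ℝ) ≤ #X := by
    exact_mod_cast card_le_card (filter_subset _ _)
  have hfr1 : (#(cell X I q) : ℝ) / #X ≤ 1 := (div_le_one hXpos).2 hcX
  have hH1 : H ≤ 1 := sub_le_self _ (pow_nonneg (by linarith) _)
  have hH0 : 1 - (1 - β) ^ m ≤ H := by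
    have : (1 - (#(cell X I q) : ℝ) / #X) ^ m ≤ (1 - β) ^ m :=
      pow_le_pow_left₀ (by linarith) (by linarith) _
    linarith
  have hH00 : 0 ≤ H := by
    have : (1 - (#(cell X I q) : ℝ) / #X) ^ m ≤ 1 := pow_le_one₀ (by linarith) (by linarith)
    linarith
  have hEin : 𝔼 s : Fin m → X, inner ℝ (c - o) (direction I c q s) =
      H * inner ℝ (c - o) (μ - c) := by
    rw [Fintype.expect_eq_sum_div_card, ← inner_sum, hsum, inner_smul_right, Fintype.card_fun,
      Fintype.card_fin, Fintype.card_coe, hH]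
    have : (1 - (#(cell X I q) : ℝ) / #X) = (#X - #(cell X I q)) / #X := by
      field_simp
    rw [this, div_pow]
    push_cast
    field_simp
  have hin : H * inner ℝ (c - o) (μ - c) ≤
      ‖c - o‖ * ‖μ - o‖ - (1 - (1 - β) ^ m) * ‖c - o‖ ^ 2 := by
    have e1 : μ - c = (μ - o) - (c - o) := by abel
    rw [e1, inner_sub_right, real_inner_self_eq_norm_sq]
    have i1 := real_inner_le_norm (c - o) (μ - o)
    have i2 : H * inner ℝ (c - o) (μ - o) ≤ ‖c - o‖ * ‖μ - o‖ :=
      calc H * inner ℝ (c - o) (μ - o) ≤ H * (‖c - o‖ * ‖μ - o‖) := by gcongr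
        _ ≤ 1 * (‖c - o‖ * ‖μ - o‖) := by gcongr
        _ = _ := one_mul _
    have i3 : (1 - (1 - β) ^ m) * ‖c - o‖ ^ 2 ≤ H * ‖c - o‖ ^ 2 := by gcongr
    linarith
  have hE2 : 𝔼 s : Fin m → X, ‖direction I c q s‖ ^ 2 ≤ R ^ 2 := by
    refine expect_le univ_nonempty fun s _ => ?_
    have := norm_direction_le (I := I) (q := q) hR0 hR s
    gcongr
  rw [expect_add_distrib, ← mul_expect, ← mul_expect, hEin]
  gcongr

variable {A : Fin k → Finset (Pt d)}

/-- One mini-batch iteration from centroids near a well-separated clustering: the step is bounded,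
and its expected effect is a contraction up to second order in the learning rate. -/
theorem WellSeparated.exists_step_bound {f γ Φ α : ℝ} (hw : WellSeparated A f γ Φ)
    (hA : IsClustering X A) (hk : 0 < k) (hα : 20 / (γ * f ^ 2) ≤ √α)
    (hp : ∀ r, √α * #X ≤ (1 - 1 / f ^ 2) * #(A r)) :
    ∃ Q : ℝ, 0 < Q ∧ ∀ (I : (Fin k → Pt d) → Pt d → Fin k), IsNearestRule I →
      ∀ (η : ℝ), 0 ≤ η → η ≤ 1 → ∀ C : Fin k → Pt d, centroidDist C A ≤ f / 2 * Φ →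
      ∃ Y : (Fin m → X) → ℝ,
        (∀ s : Fin m → X, centroidDist (step I η C fun j => (s j : Pt d)) A ≤ Y s) ∧
        (∀ s, |Y s - centroidDist C A| ≤ η * Q) ∧
        𝔼 s, Y s ≤ (1 - 2 * η * (1 - √α - (1 - √α) ^ m)) * centroidDist C A + η ^ 2 * Q := by
  have hXpos : (0 : ℝ) < #X := by
    rw [hA.card_eq]
    exact sum_pos (fun r _ => hA.card_pos r) ⟨⟨0, hk⟩, mem_univ _⟩
  have hXne : Nonempty X := by
    have : X.Nonempty := Finset.card_pos.1 (by exact_mod_cast hXpos)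
    exact this.to_subtype
  have hf0 : 0 < f := lt_trans (by norm_num) hw.lt_f
  set b := f / 2 * Φ with hb
  have hb0 : 0 < b := mul_pos (half_pos hf0) hw.scale_pos
  set R := ∑ x ∈ X, ∑ r, ‖x - means A r‖ + √b with hR
  have hR0 : 0 ≤ R := by positivity
  -- `R` bounds the distance from any point of `X` to any centroid in the neighbourhood, hence every
  -- update direction. The summand 1 only secures positivity.
  refine ⟨#X * (2 * √b * R + R ^ 2) + 1, by positivity, ?_⟩
  intro I hI η hη0 hη1 C hC
  obtain ⟨π, hπ⟩ := exists_centroidDist_eq C A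
  set D := centroidDist C A with hD
  have hD0 : 0 ≤ D := centroidDist_nonneg C A
  set V := √D with hVdef
  have hVV : V ^ 2 = D := Real.sq_sqrt hD0
  have hn1 : ∀ r, (1 : ℝ) ≤ #(A r) := fun r => by exact_mod_cast (hA.1 r).card_pos
  have hterm : ∀ r, (#(A r) : ℝ) * ‖C (π r) - means A r‖ ^ 2 ≤ D := fun r => by
    rw [← hπ]
    exact single_le_sum (f := fun r => (#(A r) : ℝ) * ‖C (π r) - means A r‖ ^ 2)
      (fun _ _ => by positivity) (mem_univ r)
  have hCV : ∀ r, √(#(A r) : ℝ) * ‖C (π r) - means A r‖ ≤ V := fun r => by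
    refine Real.le_sqrt_of_sq_le ?_
    rw [mul_pow, Real.sq_sqrt (hA.card_pos r).le]
    exact hterm r
  -- Relabelling by an optimal matching π pairs each centroid with its cluster. The same π is kept
  -- after the step, which bounds the new distance from above by `D + Z s`.
  set I' : Pt d → Fin k := fun x => π.symm (I C x) with hI'
  have hnear : ∀ x r, ‖x - C (π (I' x))‖ ≤ ‖x - C (π r)‖ := fun x r => by
    simp only [hI', Equiv.apply_symm_apply]
    exact hI C x _
  obtain ⟨hcell, hmean⟩ := hw.cell_bounds hA (C := fun r => C (π r)) (Real.sqrt_nonneg _) hCV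
    (hVV.trans_le hC) hnear
  have hcelleq : ∀ r, cell X (I C) (π r) = cell X I' r := fun r => by
    simp only [cell, hI', Equiv.symm_apply_eq]
  have hdb : ∀ r, ‖C (π r) - means A r‖ ≤ √b := fun r => by
    refine Real.le_sqrt_of_sq_le ((le_trans ?_ (hterm r)).trans hC)
    exact le_mul_of_one_le_left (by positivity) (hn1 r)
  have hxR : ∀ r, ∀ x ∈ X, ‖x - C (π r)‖ ≤ R := fun r x hx => by
    have h1 : ‖x - C (π r)‖ ≤ ‖x - means A r‖ + ‖C (π r) - means A r‖ := by
      have := norm_sub_le (x - means A r) (C (π r) - means A r)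
      rwa [sub_sub_sub_cancel_right] at this
    have h2 : ‖x - means A r‖ ≤ ∑ r, ‖x - means A r‖ :=
      single_le_sum (f := fun r => ‖x - means A r‖) (fun _ _ => norm_nonneg _) (mem_univ r)
    have h3 : ∑ r, ‖x - means A r‖ ≤ ∑ x ∈ X, ∑ r, ‖x - means A r‖ :=
      single_le_sum (f := fun x => ∑ r, ‖x - means A r‖)
        (fun _ _ => sum_nonneg fun _ _ => norm_nonneg _) hx
    linarith [hdb r]
  set ζ : Fin k → (Fin m → X) → Pt d := fun r s => direction (I C) (C (π r)) (π r) s with hζ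
  have hζR : ∀ r s, ‖ζ r s‖ ≤ R := fun r s => norm_direction_le hR0 (hxR r) s
  set Z : (Fin m → X) → ℝ := fun s => ∑ r, (#(A r) : ℝ) *
    (2 * η * inner ℝ (C (π r) - means A r) (ζ r s) + η ^ 2 * ‖ζ r s‖ ^ 2) with hZ
  have hstep : ∀ s : Fin m → X, ∑ r, (#(A r) : ℝ) *
      ‖step I η C (fun j => (s j : Pt d)) (π r) - means A r‖ ^ 2 = D + Z s := fun s => by
    rw [← hπ, hZ, ← sum_add_distrib]
    refine sum_congr rfl fun r _ => ?_
    rw [step_apply, add_sub_right_comm, norm_add_sq_real, inner_smul_right, norm_smul, mul_pow,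
      Real.norm_eq_abs, sq_abs]
    ring
  refine ⟨fun s => D + Z s, fun s => ?_, fun s => ?_, ?_⟩
  · beta_reduce
    rw [← hstep s]
    exact centroidDist_le _ A π
  · rw [add_sub_cancel_left, hZ]
    have h1 : ∀ r, |(#(A r) : ℝ) * (2 * η * inner ℝ (C (π r) - means A r) (ζ r s) +
        η ^ 2 * ‖ζ r s‖ ^ 2)| ≤ #(A r) * (η * (2 * √b * R + R ^ 2)) := fun r => by
      rw [abs_mul, Nat.abs_cast]
      gcongr
      have h2 : |inner ℝ (C (π r) - means A r) (ζ r s)| ≤ √b * R :=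
        (abs_real_inner_le_norm _ _).trans (by gcongr; exacts [hdb r, hζR r s])
      have h3 : ‖ζ r s‖ ^ 2 ≤ R ^ 2 := by gcongr; exact hζR r s
      have h4 : η ^ 2 * ‖ζ r s‖ ^ 2 ≤ η * R ^ 2 := by
        have : η ^ 2 ≤ η := by nlinarith
        gcongr
      refine (abs_add_le _ _).trans ?_
      rw [abs_mul, abs_of_nonneg (by positivity : 0 ≤ 2 * η),
        abs_of_nonneg (by positivity : 0 ≤ η ^ 2 * ‖ζ r s‖ ^ 2)]
      have h5 : 2 * η * |inner ℝ (C (π r) - means A r) (ζ r s)| ≤ 2 * η * (√b * R) := by gcongr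
      linarith
    refine (abs_sum_le_sum_abs _ _).trans ((sum_le_sum fun r _ => h1 r).trans ?_)
    rw [← sum_mul, ← hA.card_eq]
    nlinarith
  · have hE : ∀ r, 𝔼 s, (#(A r) : ℝ) *
        (2 * η * inner ℝ (C (π r) - means A r) (ζ r s) + η ^ 2 * ‖ζ r s‖ ^ 2) ≤
        2 * η * (V * (√(#(A r) : ℝ) * ‖mean (cell X I' r) - means A r‖) -
          (1 - (1 - √α) ^ m) * (#(A r) * ‖C (π r) - means A r‖ ^ 2)) +
          η ^ 2 * (#(A r) * R ^ 2) := fun r => by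
      have hcne : (cell X (I C) (π r)).Nonempty := by
        rw [hcelleq, ← Finset.card_pos]
        have h1 := hcell r
        have h2 : 0 < (1 - 1 / f ^ 2) * (#(A r) : ℝ) := by
          have := hn1 r
          have : 1 / f ^ 2 < 1 := by
            have := hw.lt_f
            rw [div_lt_one (by positivity)]
            nlinarith
          exact mul_pos (by linarith) (by linarith)
        exact_mod_cast lt_of_lt_of_le h2 h1
      have hfr : √α ≤ #(cell X (I C) (π r)) / #X := by
        rw [le_div_iff₀ hXpos, hcelleq]
        exact (hp r).trans (hcell r)
      have h1 := expect_direction_le (m := m) (means A r) (Real.sqrt_nonneg α) hXpos hcne hfr hη0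
        hR0 (hxR r)
      rw [hcelleq] at h1
      rw [← mul_expect]
      have h2 := mul_le_mul_of_nonneg_left h1 (hA.card_pos r).le
      have h6 : (#(A r) : ℝ) * (‖C (π r) - means A r‖ * ‖mean (cell X I' r) - means A r‖) ≤
          V * (√(#(A r) : ℝ) * ‖mean (cell X I' r) - means A r‖) :=
        calc (#(A r) : ℝ) * (‖C (π r) - means A r‖ * ‖mean (cell X I' r) - means A r‖)
            = (√(#(A r) : ℝ) * ‖C (π r) - means A r‖) *
                (√(#(A r) : ℝ) * ‖mean (cell X I' r) - means A r‖) := by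
              linear_combination -(‖C (π r) - means A r‖ * ‖mean (cell X I' r) - means A r‖) *
                Real.mul_self_sqrt (hA.card_pos r).le
          _ ≤ _ := mul_le_mul_of_nonneg_right (hCV r) (by positivity)
      have h7 := mul_le_mul_of_nonneg_left h6 (by positivity : 0 ≤ 2 * η)
      refine h2.trans ?_
      linarith
    have hEZ : 𝔼 s, Z s ≤ 2 * η * (V * ∑ r, √(#(A r) : ℝ) * ‖mean (cell X I' r) - means A r‖ -
        (1 - (1 - √α) ^ m) * D) + η ^ 2 * (#X * R ^ 2) := by
      rw [hZ, expect_sum_comm]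
      refine (sum_le_sum fun r _ => hE r).trans (le_of_eq ?_)
      rw [sum_add_distrib, ← mul_sum, sum_sub_distrib, ← mul_sum, ← mul_sum, hπ, ← mul_sum,
        ← sum_mul, ← hA.card_eq]
    have h10 : V * ∑ r, √(#(A r) : ℝ) * ‖mean (cell X I' r) - means A r‖ ≤ √α * D := by
      calc V * ∑ r, √(#(A r) : ℝ) * ‖mean (cell X I' r) - means A r‖
          ≤ V * (20 / (γ * f ^ 2) * V) := by gcongr
        _ ≤ V * (√α * V) := by gcongr
        _ = √α * D := by rw [← hVV]; ring
    have h11 : 2 * η * (V * ∑ r, √(#(A r) : ℝ) * ‖mean (cell X I' r) - means A r‖ -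
        (1 - (1 - √α) ^ m) * D) ≤ 2 * η * (√α * D - (1 - (1 - √α) ^ m) * D) := by gcongr
    rw [expect_add_distrib, Fintype.expect_const]
    have h12 : η ^ 2 * (#X * R ^ 2) ≤ η ^ 2 * (#X * (2 * √b * R + R ^ 2) + 1) := by
      gcongr
      have : 0 ≤ #X * (2 * √b * R) := by positivity
      linarith
    linarith

end Step

/-! ### Single-Linkage on separated samples -/

section SingleLinkage

variable {d n k : ℕ}

/-- If points with equal labels are closer to each other than points with different labels, then
Single-Linkage does not join different labels before `k` components are left. -/
theorem SingleLinkage.pure {ν : Fin n → Pt d} {l : Fin n → Fin k}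
    (hsep : ∀ i j i' j', l i = l j → l i' ≠ l j' → dist (ν i) (ν j) < dist (ν i') (ν j'))
    {Q : Finset (Finset (Fin n))} (hQ : SingleLinkage ν Q) :
    (∀ S ∈ Q, S.Nonempty) ∧ (∀ i, ∃ S ∈ Q, i ∈ S) ∧
      (k ≤ #Q → ∀ S ∈ Q, ∀ i ∈ S, ∀ j ∈ S, l i = l j) := by
  classical
  induction hQ with
  | init =>
    refine ⟨?_, fun i => ⟨{i}, by simp⟩, ?_⟩
    · simp
    · intro _ S hS i hi j hj
      simp only [mem_image, mem_univ, true_and] at hS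
      obtain ⟨a, rfl⟩ := hS
      rw [mem_singleton] at hi hj
      rw [hi, hj]
  | merge Q S T i j hQ hS hT hST hi hj hmin ih =>
    obtain ⟨hne, hcov, hpure⟩ := ih
    refine ⟨fun U hU => ?_, fun a => ?_, fun hk => ?_⟩
    · rcases mem_insert.1 hU with rfl | hU
      · exact ⟨i, mem_union_left _ hi⟩
      · exact hne U (mem_of_mem_erase (mem_of_mem_erase hU))
    · obtain ⟨U, hU, ha⟩ := hcov a
      by_cases hUS : U = S
      · exact ⟨_, mem_insert_self _ _, mem_union_left _ (hUS ▸ ha)⟩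
      by_cases hUT : U = T
      · exact ⟨_, mem_insert_self _ _, mem_union_right _ (hUT ▸ ha)⟩
      exact ⟨U, mem_insert_of_mem (mem_erase.2 ⟨hUT, mem_erase.2 ⟨hUS, hU⟩⟩), ha⟩
    -- Merging removes a component, so `k` components afterwards mean more than `k` before.
    · have hcard : k < #Q := by
        have h1 := card_insert_le (S ∪ T) ((Q.erase S).erase T)
        have h2 := card_erase_of_mem (mem_erase.2 ⟨hST.symm, hT⟩)
        have h3 := card_erase_of_mem hS
        have h4 : 1 < #Q := one_lt_card.2 ⟨S, hS, T, hT, hST⟩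
        omega
      have hp := hpure hcard.le
      have : Nonempty (Fin n) := ⟨i⟩
      choose! a ha using hne
      -- By pigeonhole two components carry the same label. Their representatives would be closer
      -- than any pair with different labels, so the closest pair that is merged has equal labels.
      obtain ⟨U, hU, W, hW, hUW, hl⟩ := exists_ne_map_eq_of_card_lt_of_maps_to
        (s := Q) (t := (univ : Finset (Fin k))) (f := fun U => l (a U))
        (by simpa using hcard) (fun _ _ => by simp)
      have hij : l i = l j := by
        by_contra hne'
        exact absurd (hmin U hU W hW hUW (a U) (ha U hU) (a W) (ha W hW))
          (not_le.2 (hsep _ _ _ _ hl hne'))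
      have key : ∀ b ∈ S ∪ T, l b = l i := fun b hb => by
        rcases mem_union.1 hb with hb | hb
        · exact hp S hS b hb i hi
        · exact (hp T hT b hb j hj).trans hij.symm
      intro U hU b hb c hc
      rcases mem_insert.1 hU with rfl | hU
      · exact (key b hb).trans (key c hc).symm
      · exact hp U (mem_of_mem_erase (mem_of_mem_erase hU)) b hb c hc

/-- The `k` pure components cover the sample and every label occurs, so sending a component to its
label is a surjection of `Fin k`, hence a permutation. -/
theorem IsBuckshotSeed.exists_perm {ν : Fin n → Pt d} {l : Fin n → Fin k}
    (hsep : ∀ i j i' j', l i = l j → l i' ≠ l j' → dist (ν i) (ν j) < dist (ν i') (ν j'))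
    (hl : Function.Surjective l) {C : Fin k → Pt d} (hC : IsBuckshotSeed ν C) :
    ∃ (π : Equiv.Perm (Fin k)) (S : Fin k → Finset (Fin n)), ∀ r, (S r).Nonempty ∧
      (∀ i ∈ S r, l i = r) ∧ C (π r) = (#(S r) : ℝ)⁻¹ • ∑ i ∈ S r, ν i := by
  classical
  obtain ⟨S, hS, hSL, hCS⟩ := hC
  obtain ⟨hne, hcov, hpure⟩ := hSL.pure hsep
  have hp := hpure (by rw [card_image_of_injective _ hS]; simp)
  have hne' : ∀ r, (S r).Nonempty := fun r => hne _ (mem_image_of_mem _ (mem_univ r))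
  choose a ha using hne'
  have hlab : ∀ r, ∀ i ∈ S r, l i = l (a r) := fun r i hi =>
    hp _ (mem_image_of_mem _ (mem_univ r)) i hi _ (ha r)
  have hsurj : Function.Surjective fun r => l (a r) := fun r => by
    obtain ⟨i, rfl⟩ := hl r
    obtain ⟨U, hU, hiU⟩ := hcov i
    obtain ⟨q, _, rfl⟩ := mem_image.1 hU
    exact ⟨q, (hlab q i hiU).symm⟩
  let σ : Equiv.Perm (Fin k) := Equiv.ofBijective _ (Finite.injective_iff_bijective.1
    (Finite.injective_iff_surjective.2 hsurj))
  refine ⟨σ.symm, fun r => S (σ.symm r), fun r => ⟨⟨_, ha _⟩, fun i hi => ?_, hCS _⟩⟩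
  rw [hlab _ i hi]
  exact σ.apply_symm_apply r

end SingleLinkage

/-! ### Seeds from typical samples -/

section Seed

variable {d k n : ℕ} {X : Finset (Pt d)} {A : Fin k → Finset (Pt d)} {f γ Φ : ℝ}

theorem norm_mean_sub_le {ι : Type*} {S : Finset ι} (hS : S.Nonempty) {ν : ι → Pt d} {o : Pt d}
    {R : ℝ} (h : ∀ i ∈ S, ‖ν i - o‖ ≤ R) : ‖(#S : ℝ)⁻¹ • ∑ i ∈ S, ν i - o‖ ≤ R := by
  have h0 : (0 : ℝ) < #S := by exact_mod_cast hS.card_pos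
  have e : (#S : ℝ)⁻¹ • ∑ i ∈ S, ν i - o = (#S : ℝ)⁻¹ • ∑ i ∈ S, (ν i - o) := by
    rw [sum_sub_distrib, sum_const, ← Nat.cast_smul_eq_nsmul ℝ, smul_sub, smul_smul _ _ o,
      inv_mul_cancel₀ h0.ne', one_smul]
  rw [e, norm_smul, norm_inv, Real.norm_natCast, inv_mul_le_iff₀ h0]
  refine (norm_sum_le_of_le _ h).trans ?_
  rw [sum_const, nsmul_eq_mul]

/-- A point of cluster `r` is central if its squared distance to the mean is at most `f / 4` times
the average over the cluster. -/
def Central (A : Fin k → Finset (Pt d)) (f : ℝ) (r : Fin k) (x : Pt d) : Prop :=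
  ‖x - means A r‖ ^ 2 ≤ f / 4 * ((∑ y ∈ A r, ‖y - means A r‖ ^ 2) / #(A r))

/-- Central points of one cluster lie in a ball of radius of order `√f * √Φ / √n_r`, while means are
separated at order `f`; the bound on size ratios makes this comparison uniform over different
clusters. Single-Linkage then returns pure components, whose means stay in the same balls. -/
theorem WellSeparated.seed_bound (hw : WellSeparated A f γ Φ) (hA : IsClustering X A)
    (hratio : ∀ r s, s ≠ r → (#(A r) : ℝ) / #(A s) < f)
    {ν : Fin n → Pt d} {l : Fin n → Fin k} (hl : Function.Surjective l)
    (hν : ∀ i, Central A f (l i) (ν i)) {C : Fin k → Pt d} (hC : IsBuckshotSeed ν C) :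
    centroidDist C A ≤ f / 4 * Φ := by
  have hf0 : 0 < f := lt_trans (by norm_num) hw.lt_f
  have h64 := sixtyFour_lt_sqrt hw.lt_f
  have hff : √f ^ 2 = f := Real.sq_sqrt hf0.le
  have hn : ∀ r, 0 < √(#(A r) : ℝ) := fun r => Real.sqrt_pos.2 (hA.card_pos r)
  have hΦ0 : 0 < √Φ := Real.sqrt_pos.2 hw.scale_pos
  set φ : Fin k → ℝ := fun r => ∑ y ∈ A r, ‖y - means A r‖ ^ 2 with hφ
  have hφ0 : ∀ r, 0 ≤ φ r := fun r => sum_nonneg fun _ _ => by positivity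
  have hφΦ : ∀ r, φ r ≤ Φ := fun r =>
    (single_le_sum (f := φ) (fun r _ => hφ0 r) (mem_univ r)).trans hw.cost_le
  have hdist : ∀ i, ‖ν i - means A (l i)‖ ≤ √f / 2 * √Φ * (1 / √(#(A (l i)) : ℝ)) := fun i => by
    refine (sq_le_sq₀ (norm_nonneg _) (by positivity)).1 ((hν i).trans ?_)
    rw [mul_pow, mul_pow, div_pow, hff, Real.sq_sqrt hw.scale_pos.le, div_pow,
      Real.sq_sqrt (hA.card_pos _).le]
    have := hφΦ (l i)
    calc f / 4 * (φ (l i) / #(A (l i))) ≤ f / 4 * (Φ / #(A (l i))) := by gcongr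
      _ = _ := by ring
  -- The bound on the size ratios enters here: it permits comparing a diameter in one cluster with
  -- the separation of two unrelated ones.
  have hrat : ∀ r s, √f * (1 / √(#(A r) : ℝ)) < f * (1 / √(#(A s) : ℝ)) := fun r s => by
    have h1 : (#(A s) : ℝ) < f * #(A r) := by
      rcases eq_or_ne r s with rfl | hrs
      · have := hA.card_pos r
        have := hw.lt_f
        nlinarith
      · exact (div_lt_iff₀ (hA.card_pos r)).1 (hratio s r hrs)
    have h2 : √(#(A s) : ℝ) < √f * √(#(A r) : ℝ) := by
      rw [← Real.sqrt_mul hf0.le]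
      exact Real.sqrt_lt_sqrt (hA.card_pos s).le h1
    rw [mul_one_div, mul_one_div, div_lt_div_iff₀ (hn r) (hn s)]
    calc √f * √(#(A s) : ℝ) < √f * (√f * √(#(A r) : ℝ)) := by gcongr
      _ = f * √(#(A r) : ℝ) := by linear_combination √(#(A r) : ℝ) * hff
  have hsep : ∀ i j i' j', l i = l j → l i' ≠ l j' →
      dist (ν i) (ν j) < dist (ν i') (ν j') := fun i j i' j' hij hne => by
    have h1 : dist (ν i) (ν j) ≤ √f * √Φ * (1 / √(#(A (l i)) : ℝ)) := by
      have hj := hdist j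
      rw [← hij, ← dist_eq_norm] at hj
      have hi := hdist i
      rw [← dist_eq_norm] at hi
      have := dist_triangle_right (ν i) (ν j) (means A (l i))
      linarith
    set a := 1 / √(#(A (l i')) : ℝ) with ha
    set b := 1 / √(#(A (l j')) : ℝ) with hb
    have h2 : f * √Φ * (a + b) ≤ dist (ν i') (ν j') + √f / 2 * √Φ * (a + b) := by
      have h3 := hw.separated (l i') (l j') hne.symm
      have hi := hdist i'
      have hj := hdist j'
      rw [← dist_eq_norm] at hi hj h3
      have h4 := dist_triangle4 (means A (l i')) (ν i') (ν j') (means A (l j'))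
      rw [dist_comm (means A (l i')) (ν i')] at h4
      linarith
    have h5 : 2 * (√f * (1 / √(#(A (l i)) : ℝ))) < f * (a + b) := by
      have := hrat (l i) (l i')
      have := hrat (l i) (l j')
      linarith
    have hab : 0 < a + b := add_pos (one_div_pos.2 (hn _)) (one_div_pos.2 (hn _))
    have h6 : √Φ * (2 * (√f * (1 / √(#(A (l i)) : ℝ)))) < √Φ * (f * (a + b)) := by gcongr
    have h7 : √f ≤ f := by nlinarith
    have h8 : √f * (√Φ * (a + b)) ≤ f * (√Φ * (a + b)) := by gcongr
    linarith
  obtain ⟨π, S, hS⟩ := hC.exists_perm hsep hl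
  refine (centroidDist_le C A π).trans ?_
  have hr : ∀ r, (#(A r) : ℝ) * ‖C (π r) - means A r‖ ^ 2 ≤ f / 4 * φ r := fun r => by
    obtain ⟨hne, hlab, hCr⟩ := hS r
    have h1 : ‖C (π r) - means A r‖ ≤ √(f / 4 * (φ r / #(A r))) := by
      rw [hCr]
      refine norm_mean_sub_le hne fun i hi => Real.le_sqrt_of_sq_le ?_
      have := hν i
      rwa [hlab i hi] at this
    have h2 : ‖C (π r) - means A r‖ ^ 2 ≤ f / 4 * (φ r / #(A r)) := by
      rw [← Real.sq_sqrt (by have := hφ0 r; positivity : 0 ≤ f / 4 * (φ r / #(A r)))]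
      gcongr
    have h0 := hA.card_pos r
    calc (#(A r) : ℝ) * ‖C (π r) - means A r‖ ^ 2 ≤ #(A r) * (f / 4 * (φ r / #(A r))) := by
          gcongr
      _ = f / 4 * φ r := by field_simp
  refine (sum_le_sum fun r _ => hr r).trans ?_
  rw [← mul_sum]
  have := hw.cost_le
  gcongr
  exact this

/-- A single noncentral point already makes the maximal squared distance exceed `f / 4` times the
average. -/
theorem wMin_le_of_not_central (hA : IsClustering X A) (hf0 : 0 < f) {r : Fin k} {x : Pt d}
    (hxr : x ∈ A r) (hxc : ¬ Central A f r x) : wMin A ≤ 4 / f := by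
  have hn := hA.card_pos r
  refine (ciInf_le (Set.finite_range _).bddBelow r).trans ?_
  simp only [Central, not_le, means] at hxc
  set avg := (∑ y ∈ A r, ‖y - mean (A r)‖ ^ 2) / (#(A r) : ℝ) with havg
  have havg0 : 0 ≤ avg := div_nonneg (sum_nonneg fun _ _ => by positivity) hn.le
  have hpos : 0 < ‖x - mean (A r)‖ ^ 2 :=
    (mul_nonneg (by linarith) havg0 : 0 ≤ f / 4 * avg).trans_lt hxc
  have hbdd : BddAbove (Set.range fun y : A r => ‖(y : Pt d) - mean (A r)‖ ^ 2) :=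
    (Set.finite_range _).bddAbove
  have hsup := le_ciSup hbdd ⟨x, hxr⟩
  rw [spreadRatio, if_neg, div_le_div_iff₀ (hpos.trans_le hsup) hf0]
  · simp only at hsup
    linarith
  · intro hall
    rw [hall x hxr] at hpos
    simp at hpos

open Classical in
/-- Markov's inequality for the squared distances to the cluster means. -/
theorem card_not_central_le (hA : IsClustering X A) (hf0 : 0 < f) :
    (#(X.filter fun x => ∃ r, x ∈ A r ∧ ¬ Central A f r x) : ℝ) ≤ 4 / f * #X := by
  have hsub : X.filter (fun x => ∃ r, x ∈ A r ∧ ¬ Central A f r x) ⊆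
      univ.biUnion fun r => (A r).filter fun x => ¬ Central A f r x := fun y hy => by
    obtain ⟨_, s, hs⟩ := mem_filter.1 hy
    exact mem_biUnion.2 ⟨s, mem_univ _, mem_filter.2 hs⟩
  have h1 : (#(X.filter fun x => ∃ r, x ∈ A r ∧ ¬ Central A f r x) : ℝ) ≤
      ∑ r, (#((A r).filter fun x => ¬ Central A f r x) : ℝ) := by
    exact_mod_cast (card_le_card hsub).trans card_biUnion_le
  refine h1.trans ?_
  rw [hA.card_eq, mul_sum]
  refine sum_le_sum fun s _ => ?_
  rcases ((A s).filter fun x => ¬ Central A f s x).eq_empty_or_nonempty with h | h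
  · rw [h]
    simp only [card_empty, Nat.cast_zero]
    positivity
  have hns := hA.card_pos s
  set φ := ∑ y ∈ A s, ‖y - means A s‖ ^ 2 with hφ
  have hm : (#((A s).filter fun x => ¬ Central A f s x) : ℝ) * (f / 4 * (φ / #(A s))) ≤ φ := by
    calc (#((A s).filter fun x => ¬ Central A f s x) : ℝ) * (f / 4 * (φ / #(A s)))
        = ∑ y ∈ (A s).filter fun x => ¬ Central A f s x, f / 4 * (φ / #(A s)) := by
          rw [sum_const, nsmul_eq_mul]
      _ ≤ ∑ y ∈ (A s).filter fun x => ¬ Central A f s x, ‖y - means A s‖ ^ 2 :=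
          sum_le_sum fun y hy => (not_le.1 (mem_filter.1 hy).2).le
      _ ≤ φ := sum_le_sum_of_subset_of_nonneg (filter_subset _ _) fun _ _ _ => by positivity
  have hφ0 : 0 < φ := by
    obtain ⟨y, hy⟩ := h
    obtain ⟨hyA, hyc⟩ := mem_filter.1 hy
    refine lt_of_lt_of_le ?_ (single_le_sum (f := fun y => ‖y - means A s‖ ^ 2)
      (fun _ _ => by positivity) hyA)
    refine lt_of_le_of_lt ?_ (not_le.1 hyc)
    exact mul_nonneg (by positivity)
      (div_nonneg (sum_nonneg fun _ _ => by positivity) (by positivity))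
  have h2 : φ * ((#((A s).filter fun x => ¬ Central A f s x) : ℝ) * (f / 4 / #(A s))) ≤ φ * 1 := by
    refine le_trans (le_of_eq ?_) (hm.trans (mul_one φ).ge)
    ring
  have h3 := le_of_mul_le_mul_left h2 hφ0
  rw [div_div, ← mul_div_assoc, div_le_one (by positivity)] at h3
  rw [div_mul_eq_mul_div, le_div_iff₀ hf0]
  linarith

open Classical in
/-- Few points are not central; there are none if the clusters are not
spread out. -/
theorem mul_card_not_central_le (hA : IsClustering X A) (hf : (64 : ℝ) ^ 2 < f) (hk : 0 < k) {ξ : ℝ}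
    {N : ℕ} (hξ : (N : ℝ) < ξ / 2 * Real.exp (2 * (f / 4 - 1) ^ 2 * wMin A ^ 2)) :
    (N : ℝ) * (#(X.filter fun x => ∃ r, x ∈ A r ∧ ¬ Central A f r x) / #X) ≤ ξ / 4 := by
  have hf0 : 0 < f := lt_trans (by norm_num) hf
  have hξ0 : 0 < ξ := by
    have : 0 < ξ / 2 * Real.exp (2 * (f / 4 - 1) ^ 2 * wMin A ^ 2) :=
      lt_of_le_of_lt (Nat.cast_nonneg N) hξ
    have := pos_of_mul_pos_left this (Real.exp_pos _).le
    linarith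
  have hXpos : (0 : ℝ) < #X := by
    rw [hA.card_eq]
    exact sum_pos (fun r _ => hA.card_pos r) ⟨⟨0, hk⟩, mem_univ _⟩
  rcases (X.filter fun x => ∃ r, x ∈ A r ∧ ¬ Central A f r x).eq_empty_or_nonempty with h | h
  · rw [h]
    simp only [card_empty, Nat.cast_zero, zero_div, mul_zero]
    linarith
  obtain ⟨x, hx⟩ := h
  obtain ⟨_, r, hxr, hxc⟩ := mem_filter.1 hx
  have hw0 : 0 ≤ wMin A := Real.iInf_nonneg fun r => by
    unfold spreadRatio
    split_ifs
    · norm_num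
    · exact div_nonneg (div_nonneg (sum_nonneg fun _ _ => by positivity) (by positivity))
        (Real.iSup_nonneg fun _ => by positivity)
  have hw1 : wMin A ≤ 4 / f := wMin_le_of_not_central hA hf0 hxr hxc
  -- With `wMin A ≤ 4 / f` the exponent is at most 2, and `exp 2 < 8`.
  have hN : (N : ℝ) ≤ 4 * ξ := by
    have h1 : (f / 4 - 1) * wMin A ≤ 1 := by
      have h2 : (f / 4 - 1) * wMin A ≤ f / 4 * (4 / f) := by
        have : 0 ≤ f / 4 - 1 := by linarith
        gcongr
        linarith
      have h3 : f / 4 * (4 / f) = 1 := by field_simp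
      linarith
    have h4 : 0 ≤ (f / 4 - 1) * wMin A := mul_nonneg (by linarith) hw0
    have h5 : 2 * (f / 4 - 1) ^ 2 * wMin A ^ 2 ≤ 2 * 1 := by
      have : ((f / 4 - 1) * wMin A) ^ 2 ≤ 1 := pow_le_one₀ h4 h1
      rw [mul_pow] at this
      linarith
    have h6 : Real.exp (2 * (f / 4 - 1) ^ 2 * wMin A ^ 2) ≤ 8 := by
      refine (Real.exp_le_exp.2 h5).trans ?_
      rw [two_mul, Real.exp_add]
      have := Real.exp_one_lt_d9
      have := Real.exp_pos 1
      nlinarith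
    have h7 : ξ / 2 * Real.exp (2 * (f / 4 - 1) ^ 2 * wMin A ^ 2) ≤ ξ / 2 * 8 := by gcongr
    linarith
  have hbad := card_not_central_le hA hf0
  have h8 : (#(X.filter fun x => ∃ r, x ∈ A r ∧ ¬ Central A f r x) : ℝ) / #X ≤ 1 / 16 := by
    rw [div_le_iff₀ hXpos]
    refine hbad.trans ?_
    have : 4 / f ≤ 1 / 16 := by
      rw [div_le_div_iff₀ hf0 (by norm_num)]
      linarith
    gcongr
  calc (N : ℝ) * (#(X.filter fun x => ∃ r, x ∈ A r ∧ ¬ Central A f r x) / #X)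
      ≤ 4 * ξ * (1 / 16) := by gcongr
    _ = ξ / 4 := by ring

end Seed

/-! ### Uniform sampling -/

section Sampling

variable {d : ℕ} {X : Finset (Pt d)} {ι Ω : Type*} [MeasurableSpace Ω] {P : Measure Ω}
  {Z : ι → Ω → X}

namespace IsUniformSampling

theorem real_setOf [IsFiniteMeasure P] (hZ : IsUniformSampling P Z) (i : ι) (p : X → Prop)
    [DecidablePred p] :
    P.real {ω | p (Z i ω)} = #{x : X | p x} / #X := by
  have h1 : {ω | p (Z i ω)} = ⋃ x ∈ univ.filter p, {ω | Z i ω = x} := by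
    ext ω
    simp
  rw [h1, measureReal_biUnion_finset]
  · have h2 : ∀ x : X, P.real {ω | Z i ω = x} = (#X : ℝ)⁻¹ := fun x => by
      rw [measureReal_def, hZ.uniform]
      simp
    rw [sum_congr rfl fun x _ => h2 x, sum_const, nsmul_eq_mul, div_eq_mul_inv]
  · intro x _ y _ hxy
    refine Set.disjoint_left.2 fun ω h1 h2 => hxy ?_
    exact h1.symm.trans h2
  · intro x _
    exact hZ.measurable i (measurableSet_singleton x)

theorem real_forall (hZ : IsUniformSampling P Z) {m : ℕ} {e : Fin m → ι}
    (he : Function.Injective e) (p : Fin m → X → Prop) :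
    P.real {ω | ∀ j, p j (Z (e j) ω)} = ∏ j, P.real {ω | p j (Z (e j) ω)} := by
  have h := (hZ.indep.precomp he).measure_inter_preimage_eq_mul univ
    (sets := fun j => {x | p j x}) fun j _ => (Set.toFinite _).measurableSet
  have h1 : {ω | ∀ j, p j (Z (e j) ω)} = ⋂ j ∈ (univ : Finset (Fin m)),
      Z (e j) ⁻¹' {x | p j x} := by
    ext ω
    simp
  rw [measureReal_def, h1, h, ENNReal.toReal_prod]
  rfl

open Classical in
/-- Extension of a finite set of draws by a default value. -/
noncomputable def extend (S : Finset ι) (x₀ : X) (y : S → X) : ι → X :=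
  fun i => if h : i ∈ S then y ⟨i, h⟩ else x₀

theorem eq_extend {β : Type*} {S : Finset ι} {g : (ι → X) → β} (hg : DependsOn g S) (x₀ : X)
    (z : ι → X) : g z = g (extend S x₀ fun i => z i) := by
  refine hg fun i hi => ?_
  rw [extend, dif_pos (mem_coe.1 hi)]

variable [Nonempty X]

/-- A function of finitely many draws factors through a finite space, so no regularity of the
seeding or tie-breaking rules is needed. -/
theorem measurable_comp (hZ : IsUniformSampling P Z) {β : Type*} [MeasurableSpace β]
    {S : Finset ι} {g : (ι → X) → β} (hg : DependsOn g S) :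
    Measurable fun ω => g fun i => Z i ω := by
  obtain ⟨x₀⟩ := ‹Nonempty X›
  have : (fun ω => g fun i => Z i ω) =
      (fun y => g (extend S x₀ y)) ∘ fun ω (i : S) => Z i ω :=
    funext fun ω => eq_extend hg x₀ _
  rw [this]
  exact (measurable_of_finite _).comp (measurable_pi_lambda _ fun i => hZ.measurable i)

theorem integrable_comp (hZ : IsUniformSampling P Z) {S : Finset ι} {g : (ι → X) → ℝ}
    (hg : DependsOn g S) (Q : Measure Ω) [IsFiniteMeasure Q] :
    Integrable (fun ω => g fun i => Z i ω) Q := by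
  classical
  have hm := hZ.measurable_comp hg
  obtain ⟨x₀⟩ := ‹Nonempty X›
  refine Integrable.of_bound hm.aestronglyMeasurable
    (∑ y : S → X, ‖g (extend S x₀ y)‖) (ae_of_all _ fun ω => ?_)
  rw [eq_extend hg x₀]
  exact single_le_sum (f := fun y : S → X => ‖g (extend S x₀ y)‖) (fun _ _ => norm_nonneg _)
    (mem_univ _)

/-- Averaging over a batch that is independent of the past. -/
theorem integral_batch [IsProbabilityMeasure P] (hZ : IsUniformSampling P Z) {m : ℕ} {e : Fin m → ι}
    (he : Function.Injective e) {S : Finset ι} (hS : ∀ j, e j ∉ S)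
    {g : (Fin m → X) → (ι → X) → ℝ} (hg : ∀ s, DependsOn (g s) S) :
    ∫ ω, g (fun j => Z (e j) ω) (fun i => Z i ω) ∂P = ∫ ω, 𝔼 s, g s (fun i => Z i ω) ∂P := by
  classical
  obtain ⟨x₀⟩ := ‹Nonempty X›
  set B : Ω → Fin m → X := fun ω j => Z (e j) ω with hB
  have hBm : Measurable B := measurable_pi_lambda _ fun j => hZ.measurable _
  have hind : IndepFun (fun ω (i : S) => Z i ω) B P := by
    have h1 := hZ.indep.indepFun_finset S (univ.image e) (by
      rw [disjoint_left]
      rintro i hi hie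
      obtain ⟨j, _, rfl⟩ := mem_image.1 hie
      exact hS j hi) hZ.measurable
    exact h1.comp (φ := id) (ψ := fun y (j : Fin m) => y ⟨e j, mem_image_of_mem _ (mem_univ j)⟩)
      measurable_id (measurable_of_finite _)
  have hprob : ∀ s, P.real {ω | B ω = s} = ((#X : ℝ) ^ m)⁻¹ := fun s => by
    have h1 : {ω | B ω = s} = {ω | ∀ j, Z (e j) ω = s j} := by
      ext ω
      simp [hB, funext_iff]
    rw [h1, hZ.real_forall he fun j x => x = s j]
    have h2 : ∀ j, P.real {ω | Z (e j) ω = s j} = (#X : ℝ)⁻¹ := fun j => by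
      rw [measureReal_def, hZ.uniform]
      simp
    rw [prod_congr rfl fun j _ => h2 j]
    simp
  -- Decomposing by the value of the batch leaves products of a function of the past draws and an
  -- indicator independent of it.
  have hsplit : ∀ ω, g (B ω) (fun i => Z i ω) =
      ∑ s, g s (fun i => Z i ω) * {ω | B ω = s}.indicator 1 ω := fun ω => by
    rw [sum_eq_single (B ω)]
    · simp
    · intro s _ hs
      rw [Set.indicator_of_notMem (fun h => hs h.symm), mul_zero]
    · simp
  have hmeas : ∀ s, MeasurableSet {ω | B ω = s} := fun s => hBm (measurableSet_singleton s)
  have hint : ∀ s, Integrable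
      (fun ω => g s (fun i => Z i ω) * {ω | B ω = s}.indicator 1 ω) P := fun s => by
    refine ((hZ.integrable_comp (hg s) P).indicator (hmeas s)).congr (ae_of_all _ fun ω => ?_)
    by_cases h : ω ∈ {ω | B ω = s} <;> simp [h]
  calc ∫ ω, g (B ω) (fun i => Z i ω) ∂P
      = ∫ ω, ∑ s, g s (fun i => Z i ω) * {ω | B ω = s}.indicator 1 ω ∂P :=
        integral_congr_ae (ae_of_all _ hsplit)
    _ = ∑ s, ∫ ω, g s (fun i => Z i ω) * {ω | B ω = s}.indicator 1 ω ∂P :=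
        integral_finsetSum _ fun s _ => hint s
    _ = ∑ s, (∫ ω, g s (fun i => Z i ω) ∂P) * ((#X : ℝ) ^ m)⁻¹ := by
        refine sum_congr rfl fun s _ => ?_
        have h2 : IndepFun (fun ω => g s (fun i => Z i ω))
            ({ω | B ω = s}.indicator (1 : Ω → ℝ)) P := by
          have h3 := hind.comp (φ := fun y => g s (extend S x₀ y))
            (ψ := ({s} : Set (Fin m → X)).indicator (1 : (Fin m → X) → ℝ))
            (measurable_of_finite _) (measurable_of_finite _)
          have e1 : (fun ω => g s (fun i => Z i ω)) =
              (fun y => g s (extend S x₀ y)) ∘ fun ω (i : S) => Z i ω :=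
            funext fun ω => eq_extend (hg s) x₀ _
          rw [e1]
          exact h3
        have h4 := h2.integral_mul_eq_mul_integral
          (hZ.integrable_comp (hg s) P).aestronglyMeasurable
          ((integrable_const (1 : ℝ)).indicator (hmeas s)).aestronglyMeasurable
        have h5 : ∫ ω, ({ω | B ω = s}.indicator 1 ω : ℝ) ∂P = ((#X : ℝ) ^ m)⁻¹ := by
          rw [integral_indicator_one (hmeas s), hprob]
        rw [← h5]
        exact h4
    _ = ∑ s, ∫ ω, g s (fun i => Z i ω) / (#X : ℝ) ^ m ∂P := by
        refine sum_congr rfl fun s _ => ?_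
        rw [integral_div, div_eq_mul_inv]
    _ = ∫ ω, ∑ s, g s (fun i => Z i ω) / (#X : ℝ) ^ m ∂P :=
        (integral_finsetSum _ fun s _ => (hZ.integrable_comp (hg s) P).div_const _).symm
    _ = ∫ ω, 𝔼 s, g s (fun i => Z i ω) ∂P := by
        refine integral_congr_ae (ae_of_all _ fun ω => ?_)
        simp only
        rw [Fintype.expect_eq_sum_div_card, sum_div, Fintype.card_fun, Fintype.card_fin,
          Fintype.card_coe]
        push_cast
        rfl

end IsUniformSampling

end Sampling

/-! ### Typical seeding samples -/

section SeedProbability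

variable {d k : ℕ} {X : Finset (Pt d)} {A : Fin k → Finset (Pt d)} {f γ Φ : ℝ}

theorem card_filter_coe (X : Finset (Pt d)) (p : Pt d → Prop) [DecidablePred p] :
    #{x : X | p x} = #(X.filter p) := by
  rw [card_filter, card_filter, ← sum_coe_sort X]

theorem IsClustering.pMin_pos (hA : IsClustering X A) (hk : 0 < k) : 0 < pMin X A := by
  have : Nonempty (Fin k) := ⟨⟨0, hk⟩⟩
  have hX : (0 : ℝ) < #X := by
    rw [hA.card_eq]
    exact sum_pos (fun r _ => hA.card_pos r) univ_nonempty
  obtain ⟨r, hr⟩ := exists_eq_ciInf_of_finite (f := fun r => (#(A r) : ℝ) / (#X : ℝ))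
  rw [pMin, ← hr]
  exact div_pos (hA.card_pos r) hX

theorem pMin_le (X : Finset (Pt d)) (A : Fin k → Finset (Pt d)) (r : Fin k) :
    pMin X A ≤ #(A r) / #X :=
  ciInf_le (Set.finite_range _).bddBelow r

/-- Union bound: the clusters missed by the sample cost `ξ / 2` in total, because `(1 - n_r / n) ^ N
≤ exp (-N * p_min)`, and noncentral sample points cost `ξ / 4`. -/
theorem WellSeparated.real_seed_le (hw : WellSeparated A f γ Φ) (hA : IsClustering X A)
    (hk : 0 < k) (hratio : ∀ r s, s ≠ r → (#(A r) : ℝ) / #(A s) < f) {ξ : ℝ} (hξ : 0 < ξ)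
    {N : ℕ} (hlog : Real.log (2 * k / ξ) / pMin X A < N)
    (hexp : (N : ℝ) < ξ / 2 * Real.exp (2 * (f / 4 - 1) ^ 2 * wMin A ^ 2))
    {ι Ω : Type*} [MeasurableSpace Ω] {P : Measure Ω} [IsProbabilityMeasure P]
    {Z : ι → Ω → X} (hZ : IsUniformSampling P Z) {e : Fin N → ι} (he : Function.Injective e)
    {seed : (Fin N → Pt d) → Fin k → Pt d} (hseed : ∀ ν, IsBuckshotSeed ν (seed ν)) :
    1 - 3 * ξ / 4 ≤
      P.real {ω | centroidDist (seed fun i => (Z (e i) ω : Pt d)) A ≤ f / 4 * Φ} := by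
  classical
  have hpm := hA.pMin_pos hk
  have hX : (0 : ℝ) < #X := by
    rw [hA.card_eq]
    exact sum_pos (fun r _ => hA.card_pos r) ⟨⟨0, hk⟩, mem_univ _⟩
  have hk' : (0 : ℝ) < k := by exact_mod_cast hk
  obtain ⟨l, hl⟩ := hA.exists_label hk
  set good := {ω | centroidDist (seed fun i => (Z (e i) ω : Pt d)) A ≤ f / 4 * Φ}
  set E : Fin k → Set Ω := fun r => {ω | ∀ i, (Z (e i) ω : Pt d) ∉ A r} with hE
  set F : Fin N → Set Ω := fun i => {ω | ∃ r, (Z (e i) ω : Pt d) ∈ A r ∧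
    ¬ Central A f r (Z (e i) ω)} with hF
  have hcover : (Set.univ : Set Ω) ⊆
      good ∪ ((⋃ r ∈ (univ : Finset (Fin k)), E r) ∪ ⋃ i ∈ (univ : Finset (Fin N)), F i) := by
    intro ω _
    by_contra hnot
    simp only [Set.mem_union, Set.mem_iUnion, mem_univ, exists_prop, true_and, not_or,
      not_exists, hE, hF, Set.mem_ofPred_eq, not_and, not_not, not_forall] at hnot
    obtain ⟨hg, hhit, hcen⟩ := hnot
    refine hg (hw.seed_bound hA hratio (l := fun i => l (Z (e i) ω)) (fun r => ?_) (fun i => ?_)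
      (hseed _))
    · obtain ⟨i, hi⟩ := hhit r
      exact ⟨i, (hl _ (Z (e i) ω).2 r).1 hi⟩
    · exact hcen i _ ((hl _ (Z (e i) ω).2 _).2 rfl)
  have hEr : ∀ r, P.real (E r) ≤ ξ / (2 * k) := fun r => by
    have h1 := hZ.real_forall he fun _ x => (x : Pt d) ∉ A r
    have h2 : ∀ i, P.real {ω | (Z (e i) ω : Pt d) ∉ A r} = 1 - #(A r) / #X := fun i => by
      rw [hZ.real_setOf (e i) fun x => (x : Pt d) ∉ A r, card_filter_coe X fun x => x ∉ A r,
        filter_notMem_eq_sdiff, cast_card_sdiff (hA.subset r), sub_div, div_self hX.ne']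
    rw [prod_congr rfl fun i _ => h2 i, prod_const, card_univ, Fintype.card_fin] at h1
    rw [hE]
    simp only
    rw [h1]
    have h3 : 1 - (#(A r) : ℝ) / #X ≤ Real.exp (-pMin X A) := by
      have := Real.add_one_le_exp (-pMin X A)
      have := pMin_le X A r
      linarith
    have h4 : 0 ≤ 1 - (#(A r) : ℝ) / #X := by
      rw [sub_nonneg, div_le_one hX]
      exact_mod_cast card_le_card (hA.subset r)
    refine (pow_le_pow_left₀ h4 h3 N).trans ?_
    rw [← Real.exp_nat_mul]
    rw [div_lt_iff₀ hpm] at hlog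
    rw [← Real.exp_log (div_pos hξ (by positivity : (0 : ℝ) < 2 * k))]
    refine Real.exp_le_exp.2 ?_
    rw [← inv_div, Real.log_inv]
    linarith
  have hFi : ∀ i, P.real (F i) = #(X.filter fun x => ∃ r, x ∈ A r ∧ ¬ Central A f r x) / #X :=
    fun i => by
      rw [← card_filter_coe X fun x => ∃ r, x ∈ A r ∧ ¬ Central A f r x]
      exact hZ.real_setOf (e i) fun x => ∃ r, (x : Pt d) ∈ A r ∧ ¬ Central A f r x
  have h1 : (1 : ℝ) ≤ P.real good + (∑ r, P.real (E r) + ∑ i, P.real (F i)) := by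
    rw [← probReal_univ (μ := P)]
    refine (measureReal_mono hcover).trans ((measureReal_union_le _ _).trans ?_)
    gcongr
    refine (measureReal_union_le _ _).trans ?_
    gcongr <;> exact measureReal_biUnion_finset_le _ _
  have h2 : ∑ r, P.real (E r) ≤ ξ / 2 := by
    refine (sum_le_sum fun r _ => hEr r).trans (le_of_eq ?_)
    rw [sum_const, card_univ, Fintype.card_fin, nsmul_eq_mul]
    field_simp
  have h3 : ∑ i, P.real (F i) ≤ ξ / 4 := by
    rw [sum_congr rfl fun i _ => hFi i, sum_const, card_univ, Fintype.card_fin, nsmul_eq_mul]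
    exact mul_card_not_central_le hA hw.lt_f hk hexp
  linarith

end SeedProbability

/-! ### The trajectory stays close to the optimal centroids -/

section Trajectory

variable {d k m N : ℕ} {X : Finset (Pt d)} {A : Fin k → Finset (Pt d)}

/-- The draws used for seeding and in the first `t` iterations. -/
def pastDraws (N m t : ℕ) : Finset (Fin N ⊕ ℕ × Fin m) :=
  univ.disjSum (range t ×ˢ univ)

/-- The trajectory as a function of the draws. -/
noncomputable def path (seed : (Fin N → Pt d) → Fin k → Pt d)
    (I : (Fin k → Pt d) → Pt d → Fin k) (c' tₒ : ℝ) (z : Fin N ⊕ ℕ × Fin m → X) :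
    ℕ → Fin k → Pt d :=
  iterates I c' tₒ (seed fun i => (z (Sum.inl i) : Pt d)) fun t j => (z (Sum.inr (t, j)) : Pt d)

variable {seed : (Fin N → Pt d) → Fin k → Pt d} {I : (Fin k → Pt d) → Pt d → Fin k} {c' tₒ : ℝ}

theorem dependsOn_path (t : ℕ) :
    DependsOn (fun z : Fin N ⊕ ℕ × Fin m → X => path seed I c' tₒ z t) (pastDraws N m t) := by
  induction t with
  | zero =>
    intro z z' h
    simp only [path, iterates]
    congr
    ext i : 1
    rw [h (Sum.inl i) (by simp [pastDraws])]
  | succ t ih =>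
    intro z z' h
    have h1 : path seed I c' tₒ z t = path seed I c' tₒ z' t := ih fun i hi => h i (by
      rcases i with i | ⟨i, j⟩ <;> simp [pastDraws] at hi ⊢
      omega)
    simp only [path, iterates] at h1 ⊢
    rw [h1]
    congr
    ext j : 1
    rw [h (Sum.inr (t, j)) (by simp [pastDraws])]

theorem pastDraws_mono {s t : ℕ} (h : s ≤ t) : pastDraws N m s ⊆ pastDraws N m t := by
  intro i hi
  rcases i with i | ⟨i, j⟩ <;> simp [pastDraws] at hi ⊢
  omega

/-- Trajectories that start close to the optimal centroids and stay near them up to time `t`. -/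
def confined (A : Fin k → Finset (Pt d)) (b : ℝ) (t : ℕ) : Set (ℕ → Fin k → Pt d) :=
  {c | centroidDist (c 0) A ≤ b / 2 ∧ ∀ i ≤ t, centroidDist (c i) A ≤ b}

theorem measurableSet_confined (A : Fin k → Finset (Pt d)) (b : ℝ) (t : ℕ) :
    MeasurableSet (confined A b t) := by
  have h : ∀ i, Measurable fun c : ℕ → Fin k → Pt d => centroidDist (c i) A := fun i =>
    (measurable_centroidDist A).comp (measurable_pi_apply i)
  have e : confined A b t = {c | centroidDist (c 0) A ≤ b / 2} ∩
      ⋂ i, ⋂ (_ : i ≤ t), {c | centroidDist (c i) A ≤ b} := by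
    ext c
    simp [confined]
  rw [e]
  exact (measurableSet_le (h 0) measurable_const).inter
    (MeasurableSet.iInter fun i => MeasurableSet.iInter fun _ =>
      measurableSet_le (h i) measurable_const)

theorem confined_succ (A : Fin k → Finset (Pt d)) (b : ℝ) (t : ℕ) :
    confined A b (t + 1) = confined A b t ∩ {c | centroidDist (c (t + 1)) A ≤ b} := by
  ext c
  simp only [confined, Set.mem_inter_iff, Set.mem_ofPred_eq]
  constructor
  · rintro ⟨h0, h⟩
    exact ⟨⟨h0, fun i hi => h i (by omega)⟩, h _ le_rfl⟩
  · rintro ⟨⟨h0, h⟩, h'⟩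
    refine ⟨h0, fun i hi => ?_⟩
    rcases Nat.lt_or_ge t i with hlt | hle
    · have : i = t + 1 := by omega
      rw [this]
      exact h'
    · exact h i hle

theorem dependsOn_confined (b : ℝ) (t : ℕ) :
    DependsOn (fun z : Fin N ⊕ ℕ × Fin m → X => path seed I c' tₒ z ∈ confined A b t)
      (pastDraws N m t) := by
  intro z z' h
  have h1 : ∀ i ≤ t, path seed I c' tₒ z i = path seed I c' tₒ z' i := fun i hi =>
    dependsOn_path i fun j hj => h j (pastDraws_mono hi hj)
  simp only [confined, Set.mem_ofPred_eq, eq_iff_iff]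
  rw [h1 0 (Nat.zero_le t)]
  exact and_congr_right fun _ => forall₂_congr fun i hi => by rw [h1 i hi]

variable {Ω : Type*} [MeasurableSpace Ω] {P : Measure Ω} {Z : Fin N ⊕ ℕ × Fin m → Ω → X}
  [Nonempty X]

theorem measurable_trajectory (hZ : IsUniformSampling P Z) :
    Measurable (trajectory seed I c' tₒ Z) :=
  measurable_pi_lambda _ fun t => hZ.measurable_comp (dependsOn_path t)

theorem integrable_trajectory (hZ : IsUniformSampling P Z) (F : (Fin k → Pt d) → ℝ) (t : ℕ)
    (Q : Measure Ω) [IsFiniteMeasure Q] :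
    Integrable (fun ω => F (trajectory seed I c' tₒ Z ω t)) Q :=
  hZ.integrable_comp (g := fun z => F (path seed I c' tₒ z t))
    (fun _ _ h => congrArg F (dependsOn_path t h)) Q

/-- Confinement up to time `t` and the centroids `C^t` depend on past draws only, so the next batch
can be averaged out pointwise on this event, where the one-step estimate `h` applies. -/
theorem setIntegral_step_le [IsProbabilityMeasure P] (hZ : IsUniformSampling P Z) {b : ℝ} {t : ℕ}
    {Ψ B : ℝ → ℝ}
    (h : ∀ C : Fin k → Pt d, centroidDist C A ≤ b → 𝔼 s : Fin m → X,
      Ψ (centroidDist (step I (c' / (((t + 1 : ℕ) : ℝ) + tₒ)) C fun j => (s j : Pt d)) A) ≤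
        B (centroidDist C A)) :
    ∫ ω in trajectory seed I c' tₒ Z ⁻¹' confined A b t,
        Ψ (centroidDist (trajectory seed I c' tₒ Z ω (t + 1)) A) ∂P ≤
      ∫ ω in trajectory seed I c' tₒ Z ⁻¹' confined A b t,
        B (centroidDist (trajectory seed I c' tₒ Z ω t) A) ∂P := by
  classical
  have hG : MeasurableSet (trajectory seed I c' tₒ Z ⁻¹' confined A b t) :=
    measurable_trajectory hZ (measurableSet_confined A b t)
  set g : (Fin m → X) → (Fin N ⊕ ℕ × Fin m → X) → ℝ := fun s z =>
    if path seed I c' tₒ z ∈ confined A b t then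
      Ψ (centroidDist (step I (c' / (((t + 1 : ℕ) : ℝ) + tₒ)) (path seed I c' tₒ z t)
        fun j => (s j : Pt d)) A) else 0 with hg
  have hgd : ∀ s, DependsOn (g s) (pastDraws N m t) := fun s z z' hz => by
    simp only [hg]
    have h1 : path seed I c' tₒ z t = path seed I c' tₒ z' t := dependsOn_path t hz
    have h2 := dependsOn_confined (seed := seed) (I := I) (c' := c') (tₒ := tₒ) (A := A) b t hz
    simp only [eq_iff_iff] at h2
    simp only [h1, h2]
  have key := hZ.integral_batch (e := fun j : Fin m => Sum.inr (t, j))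
    (fun i j hij => by simpa using hij) (S := pastDraws N m t) (by simp [pastDraws]) hgd
  rw [← integral_indicator hG, ← integral_indicator hG]
  have e1 : (trajectory seed I c' tₒ Z ⁻¹' confined A b t).indicator
      (fun ω => Ψ (centroidDist (trajectory seed I c' tₒ Z ω (t + 1)) A)) =
      fun ω => g (fun j => Z (Sum.inr (t, j)) ω) fun i => Z i ω := by
    ext ω
    rfl
  rw [e1, key]
  refine integral_mono (hZ.integrable_comp (g := fun z => 𝔼 s, g s z) (S := pastDraws N m t) ?_ P)
    ((integrable_trajectory hZ (fun C => B (centroidDist C A)) t P).indicator hG) fun ω => ?_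
  · intro z z' hz
    exact expect_congr rfl fun s _ => hgd s hz
  · by_cases hω : trajectory seed I c' tₒ Z ω ∈ confined A b t
    · have h1 : ∀ s, g s (fun i => Z i ω) =
          Ψ (centroidDist (step I (c' / (((t + 1 : ℕ) : ℝ) + tₒ))
            (trajectory seed I c' tₒ Z ω t) fun j => (s j : Pt d)) A) := fun s => if_pos hω
      simp only [h1]
      rw [Set.indicator_of_mem (by exact hω)]
      exact h _ (hω.2 t le_rfl)
    · have h1 : ∀ s, g s (fun i => Z i ω) = 0 := fun s => if_neg hω
      simp only [h1]
      rw [Set.indicator_of_notMem (by exact hω), expect_const_zero]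

end Trajectory

/-! ### Confinement by a potential, and the convergence rate -/

section Convergence

variable {d k m N : ℕ} {X : Finset (Pt d)} {A : Fin k → Finset (Pt d)}
  {I : (Fin k → Pt d) → Pt d → Fin k}

/-- In expectation, an iteration with rate `η` from a distance of at most `b` contracts the
distance to the optimal centroids at rate `2ηa`, up to an error of second order in `η`. -/
def ContractsNear (X : Finset (Pt d)) (A : Fin k → Finset (Pt d)) (m : ℕ)
    (I : (Fin k → Pt d) → Pt d → Fin k) (a b Q : ℝ) : Prop :=
  ∀ η : ℝ, 0 ≤ η → η ≤ 1 → ∀ C : Fin k → Pt d, centroidDist C A ≤ b →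
    ∃ Y : (Fin m → X) → ℝ,
      (∀ s : Fin m → X, centroidDist (step I η C fun j => (s j : Pt d)) A ≤ Y s) ∧
      (∀ s, |Y s - centroidDist C A| ≤ η * Q) ∧
      𝔼 s, Y s ≤ (1 - 2 * η * a) * centroidDist C A + η ^ 2 * Q

theorem ContractsNear.expect_le {a b Q : ℝ} (h : ContractsNear X A m I a b Q) {η : ℝ}
    (h0 : 0 ≤ η) (h1 : η ≤ 1) {C : Fin k → Pt d} (hC : centroidDist C A ≤ b) :
    𝔼 s : Fin m → X, centroidDist (step I η C fun j => (s j : Pt d)) A ≤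
      (1 - 2 * η * a) * centroidDist C A + η ^ 2 * Q := by
  obtain ⟨Y, hY, _, hE⟩ := h η h0 h1 C hC
  exact (expect_le_expect fun s _ => hY s).trans hE

/-- Keeps the increment `h` in a linear term, so that in expectation the drift, rather than the
size, of a step governs the first order. -/
theorem max_add_sq_le (x h : ℝ) : max (x + h) 0 ^ 2 ≤ (max x 0 + h) ^ 2 := by
  rcases le_total (x + h) 0 with h0 | h0
  · rw [max_eq_right h0, zero_pow two_ne_zero]
    positivity
  · rw [max_eq_left h0]
    have := le_max_left x 0
    gcongr

theorem ContractsNear.expect_sq_le [Nonempty X] {a b Q : ℝ} (h : ContractsNear X A m I a b Q)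
    (ha : 0 ≤ a) (hb : 0 ≤ b) (hQ : 0 ≤ Q) {η : ℝ} (h0 : 0 ≤ η) (h1 : η ≤ 1)
    {C : Fin k → Pt d} (hC : centroidDist C A ≤ b) :
    𝔼 s : Fin m → X,
      max (centroidDist (step I η C fun j => (s j : Pt d)) A - b / 2) 0 ^ 2 ≤
      max (centroidDist C A - b / 2) 0 ^ 2 + η ^ 2 * (b * Q + Q ^ 2) := by
  obtain ⟨Y, hY, hYb, hE⟩ := h η h0 h1 C hC
  set D := centroidDist C A
  have hD0 : 0 ≤ D := centroidDist_nonneg C A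
  set p := max (D - b / 2) 0 with hp
  have hp0 : 0 ≤ p := le_max_right _ _
  have hpb : p ≤ b / 2 := max_le (by linarith) (by linarith)
  have h2 : ∀ s : Fin m → X,
      max (centroidDist (step I η C fun j => (s j : Pt d)) A - b / 2) 0 ^ 2 ≤
      (p ^ 2 + η ^ 2 * Q ^ 2 - 2 * p * D) + 2 * p * Y s := fun s => by
    have e1 : max (centroidDist (step I η C fun j => (s j : Pt d)) A - b / 2) 0 ^ 2 ≤
        max ((D - b / 2) + (Y s - D)) 0 ^ 2 :=
      pow_le_pow_left₀ (le_max_right _ _) (max_le_max (by linarith [hY s]) le_rfl) 2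
    have e2 := max_add_sq_le (D - b / 2) (Y s - D)
    have e3 : (Y s - D) ^ 2 ≤ (η * Q) ^ 2 := by
      rw [← sq_abs]
      have := hYb s
      gcongr
    rw [mul_pow] at e3
    rw [← hp] at e2
    linarith
  refine (expect_le_expect fun s _ => h2 s).trans ?_
  rw [expect_add_distrib, ← mul_expect, Fintype.expect_const]
  -- Here the contraction is needed only as absence of upward drift.
  have h3 : 2 * p * 𝔼 s, Y s ≤ 2 * p * (D + η ^ 2 * Q) := by
    have : 0 ≤ 2 * η * a * D := by positivity
    gcongr
    linarith
  have h4 : 2 * p * (η ^ 2 * Q) ≤ 2 * (b / 2) * (η ^ 2 * Q) := by gcongr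
  linarith

variable {seed : (Fin N → Pt d) → Fin k → Pt d} {c' tₒ : ℝ}
  {Ω : Type*} [MeasurableSpace Ω] {P : Measure Ω} [IsProbabilityMeasure P]
  {Z : Fin N ⊕ ℕ × Fin m → Ω → X} [Nonempty X]

theorem learning_rate_mem (hc : 0 ≤ c') (ht : c' ≤ tₒ) (t : ℕ) :
    0 ≤ c' / (((t + 1 : ℕ) : ℝ) + tₒ) ∧ c' / (((t + 1 : ℕ) : ℝ) + tₒ) ≤ 1 := by
  have h : (0 : ℝ) < ((t + 1 : ℕ) : ℝ) + tₒ := by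
    push_cast
    have : (0 : ℝ) ≤ t := Nat.cast_nonneg t
    linarith
  refine ⟨div_nonneg hc h.le, (div_le_one h).2 ?_⟩
  push_cast
  have : (0 : ℝ) ≤ t := Nat.cast_nonneg t
  linarith

/-- The probability of leaving the neighbourhood of the optimal centroids is `O(1 / tₒ)`. -/
theorem ContractsNear.real_confined_zero_sub_le {a b Q : ℝ} (h : ContractsNear X A m I a b Q)
    (hZ : IsUniformSampling P Z) (ha : 0 ≤ a) (hb : 0 ≤ b) (hQ : 0 ≤ Q) (hc : 0 ≤ c')
    (ht : c' ≤ tₒ) (ht0 : 0 < tₒ) (t : ℕ) :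
    b ^ 2 / 4 * (P.real (trajectory seed I c' tₒ Z ⁻¹' confined A b 0) -
      P.real (trajectory seed I c' tₒ Z ⁻¹' confined A b t)) ≤
        (b * Q + Q ^ 2) * c' ^ 2 * (1 / tₒ) := by
  set G : ℕ → Set Ω := fun t => trajectory seed I c' tₒ Z ⁻¹' confined A b t with hG
  have hGm : ∀ t, MeasurableSet (G t) := fun t =>
    measurable_trajectory hZ (measurableSet_confined A b t)
  have hGs : ∀ t, G (t + 1) ⊆ G t := fun t ω hω => by
    simp only [hG, Set.mem_preimage, confined_succ] at hω ⊢
    exact hω.1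
  set Ψ : ℝ → ℝ := fun x => max (x - b / 2) 0 ^ 2 with hΨ
  set D : ℕ → Ω → ℝ := fun t ω => centroidDist (trajectory seed I c' tₒ Z ω t) A with hD
  set w : ℕ → ℝ := fun t => ∫ ω in G t, Ψ (D t ω) ∂P with hw
  have hint : ∀ t, Integrable (fun ω => Ψ (D t ω)) P := fun t =>
    integrable_trajectory hZ (fun C => Ψ (centroidDist C A)) t P
  have hw0 : ∀ t, 0 ≤ w t := fun t => integral_nonneg fun ω => by positivity
  -- Potential still held on `G t` plus the amount carried off by trajectories that have left: each
  -- departure removes at least `b ^ 2 / 4`. The right-hand side telescopes the sum of squared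
  -- rates.
  have main : ∀ t : ℕ, w t + b ^ 2 / 4 * (P.real (G 0) - P.real (G t)) ≤
      (b * Q + Q ^ 2) * c' ^ 2 * (1 / tₒ - 1 / (t + tₒ)) := by
    intro t
    induction t with
    | zero =>
      have : w 0 = 0 := setIntegral_eq_zero_of_forall_eq_zero fun ω hω => by
        have h1 : D 0 ω ≤ b / 2 := hω.1
        simp only [hΨ]
        rw [max_eq_right (by linarith)]
        norm_num
      rw [this]
      simp
    | succ t ih =>
      obtain ⟨hη0, hη1⟩ := learning_rate_mem hc ht t
      have h1 := setIntegral_step_le (seed := seed) (A := A) (Ψ := Ψ)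
        (B := fun x => Ψ x + (c' / (((t + 1 : ℕ) : ℝ) + tₒ)) ^ 2 * (b * Q + Q ^ 2)) (t := t)
        hZ (fun C hC => h.expect_sq_le ha hb hQ hη0 hη1 hC)
      rw [integral_add (hint t).integrableOn (integrable_const _), setIntegral_const,
        smul_eq_mul] at h1
      have h2 : ∫ ω in G t, Ψ (D (t + 1) ω) ∂P =
          w (t + 1) + ∫ ω in G t \ G (t + 1), Ψ (D (t + 1) ω) ∂P := by
        rw [← integral_inter_add_sdiff (hGm (t + 1)) (hint (t + 1)).integrableOn,
          Set.inter_eq_self_of_subset_right (hGs t)]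
      have h3 : b ^ 2 / 4 * (P.real (G t) - P.real (G (t + 1))) ≤
          ∫ ω in G t \ G (t + 1), Ψ (D (t + 1) ω) ∂P := by
        rw [← measureReal_sdiff (hGs t) (hGm (t + 1)), mul_comm, ← smul_eq_mul,
          ← setIntegral_const]
        refine setIntegral_mono_on (integrable_const _) (hint (t + 1)).integrableOn
          ((hGm t).diff (hGm (t + 1))) fun ω hω => ?_
        have h4 : b < D (t + 1) ω := by
          by_contra hle
          refine hω.2 ?_
          simp only [hG, Set.mem_preimage, confined_succ]
          exact ⟨hω.1, not_lt.1 hle⟩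
        calc b ^ 2 / 4 = (b / 2) ^ 2 := by ring
          _ ≤ Ψ (D (t + 1) ω) := by
            simp only [hΨ]
            gcongr
            exact le_max_of_le_left (by linarith)
      have h5 : P.real (G t) * ((c' / (((t + 1 : ℕ) : ℝ) + tₒ)) ^ 2 * (b * Q + Q ^ 2)) ≤
          1 * ((c' / (((t + 1 : ℕ) : ℝ) + tₒ)) ^ 2 * (b * Q + Q ^ 2)) := by
        gcongr
        exact measureReal_le_one
      have ht' : (0 : ℝ) < t + tₒ := by positivity
      have h6 : (c' / (((t + 1 : ℕ) : ℝ) + tₒ)) ^ 2 * (b * Q + Q ^ 2) ≤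
          (b * Q + Q ^ 2) * c' ^ 2 * (1 / (t + tₒ) - 1 / (((t + 1 : ℕ) : ℝ) + tₒ)) := by
        have h7 : (1 / (((t + 1 : ℕ) : ℝ) + tₒ)) ^ 2 ≤
            1 / (t + tₒ) - 1 / (((t + 1 : ℕ) : ℝ) + tₒ) := by
          push_cast
          have e : 1 / ((t : ℝ) + tₒ) - 1 / (t + 1 + tₒ) =
              1 / ((t + tₒ) * (t + 1 + tₒ)) := by
            field_simp
            ring
          rw [e, one_div_pow]
          refine one_div_le_one_div_of_le (by positivity) ?_
          nlinarith
        have h8 := mul_le_mul_of_nonneg_left h7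
          (by positivity : 0 ≤ (b * Q + Q ^ 2) * c' ^ 2)
        calc _ = (b * Q + Q ^ 2) * c' ^ 2 * (1 / (((t + 1 : ℕ) : ℝ) + tₒ)) ^ 2 := by ring
          _ ≤ _ := h8
      have h1' : ∫ ω in G t, Ψ (D (t + 1) ω) ∂P ≤ w t +
          P.real (G t) * ((c' / (((t + 1 : ℕ) : ℝ) + tₒ)) ^ 2 * (b * Q + Q ^ 2)) := h1
      linarith
  have h9 := main t
  have h10 : 0 ≤ (b * Q + Q ^ 2) * c' ^ 2 * (1 / (t + tₒ)) := by positivity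
  linarith [hw0 t]

/-- Induction closes because the contraction coefficient exceeds 1 by κ: this surplus yields `M * κ
/ (τ * (τ + 1))`, which absorbs the noise `q / (τ + 1) ^ 2`. The condition `κ ≤ tₒ` keeps the factor
of `u t` nonnegative. -/
theorem recursion_le {u : ℕ → ℝ} {κ q M tₒ : ℝ} (hκ : 0 < κ) (ht : κ ≤ tₒ)
    (h0 : u 0 ≤ M / tₒ) (hM : q ≤ M * κ) (hM0 : 0 ≤ M)
    (h : ∀ t : ℕ, u (t + 1) ≤
      (1 - (1 + κ) / (((t + 1 : ℕ) : ℝ) + tₒ)) * u t + q / (((t + 1 : ℕ) : ℝ) + tₒ) ^ 2)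
    (t : ℕ) : u t ≤ M / (t + tₒ) := by
  induction t with
  | zero => simpa using h0
  | succ t ih =>
    refine (h t).trans ?_
    push_cast
    have ht0 : (0 : ℝ) ≤ t := Nat.cast_nonneg t
    set τ := (t : ℝ) + tₒ with hτ
    have hτ0 : 0 < τ := by linarith
    have e : (t : ℝ) + 1 + tₒ = τ + 1 := by rw [hτ]; ring
    rw [e]
    have h1 : 0 ≤ 1 - (1 + κ) / (τ + 1) := by
      rw [sub_nonneg, div_le_one (by positivity)]
      linarith
    calc (1 - (1 + κ) / (τ + 1)) * u t + q / (τ + 1) ^ 2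
        ≤ (1 - (1 + κ) / (τ + 1)) * (M / τ) + M * κ / (τ + 1) ^ 2 := by gcongr
      _ ≤ M / (τ + 1) := by
        have e2 : M / (τ + 1) - ((1 - (1 + κ) / (τ + 1)) * (M / τ) + M * κ / (τ + 1) ^ 2) =
            M * κ / (τ * (τ + 1) ^ 2) := by
          field_simp
          ring
        have : 0 ≤ M * κ / (τ * (τ + 1) ^ 2) := by positivity
        linarith

/-- On the event that the trajectory stays near the optimal centroids, the expected distance
decays like `1 / t`. -/
theorem ContractsNear.setIntegral_le {a b Q : ℝ} (h : ContractsNear X A m I a b Q)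
    (hZ : IsUniformSampling P Z) (hb : 0 ≤ b) (hQ : 0 ≤ Q) (hc : 0 ≤ c')
    (hca : 1 < 2 * c' * a) (ht : c' ≤ tₒ) (ht' : 2 * c' * a - 1 ≤ tₒ) (t : ℕ) :
    ∫ ω in trajectory seed I c' tₒ Z ⁻¹' confined A b t,
        centroidDist (trajectory seed I c' tₒ Z ω t) A ∂P ≤
      (b * tₒ + c' ^ 2 * Q / (2 * c' * a - 1)) / (t + tₒ) := by
  have hκ : 0 < 2 * c' * a - 1 := by linarith
  have ht0 : 0 < tₒ := by linarith
  have hint : ∀ t, Integrable (fun ω => centroidDist (trajectory seed I c' tₒ Z ω t) A) P :=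
    fun t => integrable_trajectory hZ (fun C => centroidDist C A) t P
  have hGm : ∀ t, MeasurableSet (trajectory seed I c' tₒ Z ⁻¹' confined A b t) := fun t =>
    measurable_trajectory hZ (measurableSet_confined A b t)
  -- In the numerator, `b * tₒ` covers the start and the other summand covers the noise.
  refine recursion_le (u := fun t => ∫ ω in trajectory seed I c' tₒ Z ⁻¹' confined A b t,
    centroidDist (trajectory seed I c' tₒ Z ω t) A ∂P) (κ := 2 * c' * a - 1) (q := c' ^ 2 * Q)
    hκ ht' ?_ ?_ (by positivity) (fun t => ?_) t
  · have h1 : ∫ ω in trajectory seed I c' tₒ Z ⁻¹' confined A b 0,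
        centroidDist (trajectory seed I c' tₒ Z ω 0) A ∂P ≤
        ∫ ω in trajectory seed I c' tₒ Z ⁻¹' confined A b 0, b ∂P :=
      setIntegral_mono_on (hint 0).integrableOn (integrable_const _) (hGm 0) fun ω hω =>
        hω.2 0 le_rfl
    rw [setIntegral_const, smul_eq_mul] at h1
    have h2 : P.real (trajectory seed I c' tₒ Z ⁻¹' confined A b 0) * b ≤ 1 * b := by
      gcongr
      exact measureReal_le_one
    refine h1.trans (h2.trans ?_)
    rw [le_div_iff₀ ht0, one_mul]
    have : 0 ≤ c' ^ 2 * Q / (2 * c' * a - 1) := by positivity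
    linarith
  · rw [add_mul, div_mul_cancel₀ _ hκ.ne']
    have : 0 ≤ b * tₒ * (2 * c' * a - 1) := by positivity
    linarith
  · obtain ⟨hη0, hη1⟩ := learning_rate_mem hc ht t
    set η := c' / (((t + 1 : ℕ) : ℝ) + tₒ) with hη
    have h1 := setIntegral_step_le (seed := seed) (A := A) (Ψ := fun x => x) (b := b)
      (B := fun x => (1 - 2 * η * a) * x + η ^ 2 * Q) (t := t)
      hZ (fun C hC => h.expect_le hη0 hη1 hC)
    rw [integral_add ((hint t).integrableOn.const_mul _) (integrable_const _),
      integral_const_mul, setIntegral_const, smul_eq_mul] at h1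
    have h2 : ∫ ω in trajectory seed I c' tₒ Z ⁻¹' confined A b (t + 1),
        centroidDist (trajectory seed I c' tₒ Z ω (t + 1)) A ∂P ≤
        ∫ ω in trajectory seed I c' tₒ Z ⁻¹' confined A b t,
        centroidDist (trajectory seed I c' tₒ Z ω (t + 1)) A ∂P := by
      refine setIntegral_mono_set (hint (t + 1)).integrableOn
        (ae_of_all _ fun ω => centroidDist_nonneg _ A) (Filter.Eventually.of_forall fun ω hω => ?_)
      have hω' : trajectory seed I c' tₒ Z ω ∈ confined A b (t + 1) := hω
      rw [confined_succ] at hω'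
      exact hω'.1
    have h3 : P.real (trajectory seed I c' tₒ Z ⁻¹' confined A b t) * (η ^ 2 * Q) ≤
        1 * (η ^ 2 * Q) := by
      gcongr
      exact measureReal_le_one
    refine h2.trans (h1.trans ?_)
    have e1 : (1 + (2 * c' * a - 1)) / (((t + 1 : ℕ) : ℝ) + tₒ) = 2 * η * a := by
      rw [hη]
      ring
    have e2 : c' ^ 2 * Q / (((t + 1 : ℕ) : ℝ) + tₒ) ^ 2 = η ^ 2 * Q := by
      rw [hη, div_pow, div_mul_eq_mul_div]
    rw [e1, e2]
    linarith

end Convergence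

/-! ### Consequences of the assumptions -/

section Assumptions

variable {d k : ℕ} {X : Finset (Pt d)} {A : Fin k → Finset (Pt d)} {α f γ : ℝ}

theorem eq_means_of_clusterCost_eq_zero (h0 : clusterCost A = 0) {r : Fin k}
    {x : Pt d} (hx : x ∈ A r) : x = means A r := by
  unfold clusterCost costWith at h0
  have h1 := (sum_eq_zero_iff_of_nonneg fun r _ =>
    sum_nonneg fun x _ => by positivity).1 h0 r (mem_univ r)
  have h2 := (sum_eq_zero_iff_of_nonneg fun x _ => by positivity).1 h1 x hx
  exact sub_eq_zero.1 (norm_eq_zero.1 (pow_eq_zero_iff two_ne_zero |>.1 h2))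

/-- The optimal cost itself serves as scale unless it is zero; then the clusters are distinct single
points, and a scale can be chosen from their smallest distance. -/
theorem IsOptimalClustering.exists_wellSeparated (hA : IsOptimalClustering X A)
    (hB1 : MeanSeparation A α f) (hB2 : HasMargin A f γ) (hk : 0 < k) :
    ∃ Φ, WellSeparated A f γ Φ := by
  have hf0 : 0 < f := lt_trans (by norm_num) hB1.lt_f
  rcases (clusterCost_nonneg A).eq_or_lt with h0 | hpos
  · have hne : ∀ r s, s ≠ r → 0 < ‖means A r - means A s‖ := fun r s hsr => by
      rw [norm_pos_iff, sub_ne_zero]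
      intro heq
      obtain ⟨x, hx⟩ := hA.1.1 r
      obtain ⟨y, hy⟩ := hA.1.1 s
      have hxy : x = y := by
        rw [eq_means_of_clusterCost_eq_zero h0.symm hx,
          eq_means_of_clusterCost_eq_zero h0.symm hy, heq]
      exact disjoint_left.1 (hA.1.2.1 s r hsr) hy (hxy ▸ hx)
    obtain ⟨ℓ, hℓ0, hℓ⟩ : ∃ ℓ : ℝ, 0 < ℓ ∧ ∀ r s, s ≠ r → ℓ ≤ ‖means A r - means A s‖ := by
      have : Nonempty (Fin k × Fin k) := ⟨⟨⟨0, hk⟩, ⟨0, hk⟩⟩⟩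
      obtain ⟨p, hp⟩ := Finite.exists_min fun p : Fin k × Fin k =>
        if p.2 = p.1 then 1 else ‖means A p.1 - means A p.2‖
      refine ⟨_, ?_, fun r s hsr => (hp (r, s)).trans (by simp [hsr])⟩
      split_ifs with h
      · exact one_pos
      · exact hne _ _ h
    -- The 2 compensates for the sum of two terms `1 / √n ≤ 1`.
    refine ⟨(ℓ / (2 * f)) ^ 2, hB1.lt_f, hB2.lt_gamma, by positivity, ?_, fun r s hsr => ?_,
      fun r s hsr x hx => hA.sq_gap hB2 hsr hx⟩
    · rw [← h0]
      positivity
    · rw [Real.sqrt_sq (by positivity)]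
      have h1 : ∀ r, 1 / √(#(A r) : ℝ) ≤ 1 := fun r => by
        have : (1 : ℝ) ≤ √(#(A r) : ℝ) :=
          Real.one_le_sqrt.2 (by exact_mod_cast (hA.1.1 r).card_pos)
        exact (div_le_one (by linarith)).2 this
      calc f * (ℓ / (2 * f)) * (1 / √(#(A r) : ℝ) + 1 / √(#(A s) : ℝ))
          ≤ f * (ℓ / (2 * f)) * (1 + 1) := by
            gcongr
            exacts [h1 r, h1 s]
        _ = ℓ := by field_simp; norm_num
        _ ≤ _ := hℓ r s hsr
  · exact ⟨clusterCost A, hB1.lt_f, hB2.lt_gamma, hpos, le_rfl, hB1.separated,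
      fun r s hsr x hx => hA.sq_gap hB2 hsr hx⟩

/-- For `k = 0` the infimum `pMin` takes its default value 0, below `√α`. -/
theorem pos_of_clusterBalance (hB1 : MeanSeparation A α f) (hB2 : HasMargin A f γ)
    (hB3 : ClusterBalance X A α f γ) : 0 < k := by
  rcases Nat.eq_zero_or_pos k with rfl | hk
  · exfalso
    have hf0 : 0 < f := lt_trans (by norm_num) hB1.lt_f
    have hγ0 : 0 < γ := lt_of_le_of_lt (by positivity) hB2.lt_gamma
    have h1 : pMin X A = 0 := Real.iInf_of_isEmpty _
    have h2 : 0 < √α := Real.sqrt_pos.2 hB1.alpha_pos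
    have h3 : 0 < γ / (16 ^ 2 * f) := by positivity
    have h4 : γ / (16 ^ 2 * f) + √α ≤ pMin X A := hB3
    linarith
  · exact hk

/-- The shift of the cell means costs at most `√α` of the contraction rate: the lower bound on `f`
in terms of α gives `√α * √f ≥ 1 / 8`, and the margin gives `γ * √f ≥ 8`. -/
theorem MeanSeparation.div_le_sqrt (hB1 : MeanSeparation A α f) (hγ : 8 * √2 / √f < γ) :
    20 / (γ * f ^ 2) ≤ √α := by
  have hf := hB1.lt_f
  have hα := hB1.alpha_pos
  have hf0 : 0 < f := lt_trans (by norm_num) hf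
  have hγ0 : 0 < γ := lt_of_le_of_lt (by positivity) hγ
  have h2 : 1 ≤ √2 := Real.one_le_sqrt.2 (by norm_num)
  have h1 := lt_mul_sqrt hf hγ
  have hff : √f * √f = f := Real.mul_self_sqrt hf0.le
  have h3 : 5 * α + 5 < f * (256 * α) := (div_lt_iff₀ (by positivity)).1 hB1.alpha_lt_f
  have h4 : 1 / 8 ≤ √α * √f := by
    rw [← Real.sqrt_mul hα.le]
    refine Real.le_sqrt_of_sq_le ?_
    linarith
  rw [div_le_iff₀ (by positivity)]
  calc (20 : ℝ) ≤ 1 / 8 * 8 * 64 ^ 2 := by norm_num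
    _ ≤ (√α * √f) * (γ * √f) * f := by
      gcongr
      linarith
    _ = √α * (γ * f ^ 2) := by linear_combination √α * γ * f * hff

/-- The surplus `γ / (16 ^ 2 * f)` in the balance condition pays for the fraction `1 / f ^ 2` of
points that a cell may lose. -/
theorem ClusterBalance.sqrt_mul_card_le (hA : IsClustering X A)
    (hB3 : ClusterBalance X A α f γ) (hf : (64 : ℝ) ^ 2 < f) (hγ : 8 * √2 / √f < γ) (r : Fin k) :
    √α * #X ≤ (1 - 1 / f ^ 2) * #(A r) := by
  have hf0 : 0 < f := lt_trans (by norm_num) hf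
  have hγ0 : 0 < γ := lt_of_le_of_lt (by positivity) hγ
  have h2 : 1 ≤ √2 := Real.one_le_sqrt.2 (by norm_num)
  have h1 := lt_mul_sqrt hf hγ
  have h64 := sixtyFour_lt_sqrt hf
  have hff : √f * √f = f := Real.mul_self_sqrt hf0.le
  have hle : (#(A r) : ℝ) ≤ #X := by exact_mod_cast card_le_card (hA.subset r)
  have hX : (0 : ℝ) < #X := (hA.card_pos r).trans_le hle
  have h3 : γ / (16 ^ 2 * f) + √α ≤ #(A r) / #X := le_trans hB3 (pMin_le X A r)
  have h4 : 1 / f ^ 2 ≤ γ / (16 ^ 2 * f) := by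
    rw [div_le_div_iff₀ (by positivity) (by positivity)]
    have h5 : 8 * 64 ≤ γ * √f * √f := by
      gcongr
      linarith
    have h6 : 8 * 64 * f ≤ γ * f * f := by
      rw [mul_assoc γ, hff] at h5
      gcongr
    nlinarith
  have h7 : (√α + 1 / f ^ 2) * #X ≤ #(A r) := by
    rw [← le_div_iff₀ hX]
    linarith
  have h8 : 1 / f ^ 2 * (#(A r) : ℝ) ≤ 1 / f ^ 2 * #X := by gcongr
  linarith

theorem rate_pos {x : ℝ} (h0 : 0 < x) (h1 : x < 1) {m : ℕ} (hm : 1 < m) :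
    0 < 1 - x - (1 - x) ^ m := by
  have : (1 - x) ^ m ≤ (1 - x) ^ 2 := pow_le_pow_of_le_one (by linarith) (by linarith) hm
  nlinarith

theorem le_rho (hA : IsClustering X A) (hk : 0 < k) (hB3 : ClusterBalance X A α f γ)
    (hf0 : 0 < f) (hγ0 : 0 < γ) (m : ℕ) : 1 - (1 - √α) ^ m ≤ rho X A f γ m := by
  have h1 : γ / (16 ^ 2 * f) + √α ≤ pMin X A := hB3
  have h2 : pMin X A ≤ 1 := by
    refine (pMin_le X A ⟨0, hk⟩).trans (div_le_one_of_le₀ ?_ (Nat.cast_nonneg _))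
    exact_mod_cast card_le_card (hA.subset _)
  have h3 : 0 < γ / (16 ^ 2 * f) := by positivity
  have h4 : (1 - (pMin X A - γ / (16 ^ 2 * f))) ^ m ≤ (1 - √α) ^ m :=
    pow_le_pow_left₀ (by linarith) (by linarith) m
  unfold rho
  linarith

theorem integral_cond_eq {Ω : Type*} [MeasurableSpace Ω] (P : Measure Ω) (G : Set Ω)
    (F : Ω → ℝ) : ∫ ω, F ω ∂P[|G] = (P.real G)⁻¹ * ∫ ω in G, F ω ∂P := by
  rw [ProbabilityTheory.cond, integral_smul_measure, ENNReal.toReal_inv, smul_eq_mul]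
  rfl

end Assumptions

end KMeans

/-! ### Choice of constants and conclusion -/

theorem mainTheorem2 {d k : ℕ} (X : Finset (KMeans.Pt d))
    (A : Fin k → Finset (KMeans.Pt d)) (hA : KMeans.IsOptimalClustering X A)
    (α f γ : ℝ)
    (hB1 : KMeans.MeanSeparation A α f)
    (hB2 : KMeans.HasMargin A f γ)
    (hB3 : KMeans.ClusterBalance X A α f γ)
    (m : ℕ) (hm : 1 < m) (c' : ℝ)
    (hc' : 1 / (2 * (1 - √α - (1 - √α) ^ m)) < c') :
    ∃ K : ℝ, 0 < K ∧
      ∀ (ξ δ tₒ : ℝ) (mₒ : ℕ), 0 < ξ → ξ < 1 → 0 < δ → δ ≤ Real.exp (-1) →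
        5 * √(1 / (2 * KMeans.wMin A) *
            Real.log (2 / (ξ * KMeans.pMin X A) * Real.log (2 * k / ξ))) ≤ f →
        Real.log (2 * k / ξ) / KMeans.pMin X A < mₒ →
        (mₒ : ℝ) < ξ / 2 * Real.exp (2 * (f / 4 - 1) ^ 2 * KMeans.wMin A ^ 2) →
        K * (c' ^ 2 / (KMeans.rho X A f γ m ^ 2 * (2 * c' * (KMeans.rho X A f γ m - √α) - 1)) *
              Real.log (1 / δ)) ^ (2 / (2 * c' * (KMeans.rho X A f γ m - √α) - 1)) ≤ tₒ →
        ∃ M : ℝ,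
          ∀ (seed : (Fin mₒ → KMeans.Pt d) → Fin k → KMeans.Pt d)
            (I : (Fin k → KMeans.Pt d) → KMeans.Pt d → Fin k),
            (∀ ν, KMeans.IsBuckshotSeed ν (seed ν)) → KMeans.IsNearestRule I →
            ∀ (Ω : Type*) [MeasurableSpace Ω] (P : Measure Ω) [IsProbabilityMeasure P]
              (Z : Fin mₒ ⊕ ℕ × Fin m → Ω → X), KMeans.IsUniformSampling P Z →
              ∀ t : ℕ, 1 ≤ t → ∃ G : Set Ω,
                (∃ T : Set (ℕ → Fin k → KMeans.Pt d), MeasurableSet T ∧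
                  G = KMeans.trajectory seed I c' tₒ Z ⁻¹' T) ∧
                MeasurableSet G ∧
                (1 - δ) * (1 - ξ) ≤ P.real G ∧
                Integrable (fun ω => KMeans.cost X (KMeans.trajectory seed I c' tₒ Z ω t)) P[|G] ∧
                Integrable
                  (fun ω => KMeans.centroidDist (KMeans.trajectory seed I c' tₒ Z ω t) A) P[|G] ∧
                (∫ ω, KMeans.cost X (KMeans.trajectory seed I c' tₒ Z ω t) ∂P[|G])
                    - KMeans.clusterCost A ≤
                  ∫ ω, KMeans.centroidDist (KMeans.trajectory seed I c' tₒ Z ω t) A ∂P[|G] ∧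
                (∫ ω, KMeans.centroidDist (KMeans.trajectory seed I c' tₒ Z ω t) A ∂P[|G])
                  ≤ M / t := by
  have hk := KMeans.pos_of_clusterBalance hB1 hB2 hB3
  have hf0 : 0 < f := lt_trans (by norm_num) hB1.lt_f
  have hγ0 : 0 < γ := lt_of_le_of_lt (by positivity) hB2.lt_gamma
  have hcl := hA.1
  obtain ⟨Φ, hw⟩ := hA.exists_wellSeparated hB1 hB2 hk
  obtain ⟨Q, hQ0, hQ⟩ := hw.exists_step_bound (m := m) hcl hk (hB1.div_le_sqrt hB2.lt_gamma)
    (hB3.sqrt_mul_card_le hcl hB1.lt_f hB2.lt_gamma)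
  have hα0 : 0 < √α := Real.sqrt_pos.2 hB1.alpha_pos
  have hα1 : √α < 1 := by
    rw [Real.sqrt_lt' one_pos, one_pow]
    exact hB1.alpha_lt_one
  set a := 1 - √α - (1 - √α) ^ m with ha
  have ha0 : 0 < a := KMeans.rate_pos hα0 hα1 hm
  have hc0 : 0 < c' := lt_trans (by positivity) hc'
  have hca : 1 < 2 * c' * a := by
    rw [div_lt_iff₀ (by positivity)] at hc'
    linarith
  set b := f / 2 * Φ with hb
  have hb0 : 0 < b := mul_pos (half_pos hf0) hw.scale_pos
  set ρ := KMeans.rho X A f γ m with hρ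
  have hρa : a + √α ≤ ρ := by
    have := KMeans.le_rho hcl hk hB3 hf0 hγ0 m
    linarith
  have hρ0 : 0 < ρ := by linarith
  have hβ : 0 < 2 * c' * (ρ - √α) - 1 := by
    have : 2 * c' * a ≤ 2 * c' * (ρ - √α) := by
      gcongr
      linarith
    linarith
  set β := 2 * c' * (ρ - √α) - 1 with hβdef
  set ε := Real.exp (-(2 * (f / 4 - 1) ^ 2 * KMeans.wMin A ^ 2)) / 2 with hε
  have hε0 : 0 < ε := by positivity
  set S := (b * Q + Q ^ 2) * c' ^ 2 / (b ^ 2 / 4 * ε) with hS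
  have hS0 : 0 < S := by positivity
  set T := c' + (2 * c' * a - 1) + S with hT
  have hT0 : 0 < T := by linarith
  have hc00 : 0 < c' ^ 2 / (ρ ^ 2 * β) := by positivity
  -- Since `log (1 / δ) ≥ 1`, dividing by the power without the logarithm ensures `T ≤ tₒ` for every
  -- admissible δ.
  refine ⟨T / (c' ^ 2 / (ρ ^ 2 * β)) ^ (2 / β), by positivity, ?_⟩
  intro ξ δ tₒ mₒ hξ0 hξ1 hδ0 hδ _ hlog hexp htₒ
  have hTt : T ≤ tₒ := by
    refine le_trans ?_ htₒ
    have h1 : 1 ≤ Real.log (1 / δ) := by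
      rw [one_div, Real.log_inv, le_neg]
      rw [← Real.log_exp (-1)]
      exact Real.log_le_log hδ0 hδ
    have h2 : (c' ^ 2 / (ρ ^ 2 * β)) ^ (2 / β) ≤
        (c' ^ 2 / (ρ ^ 2 * β) * Real.log (1 / δ)) ^ (2 / β) :=
      Real.rpow_le_rpow hc00.le (le_mul_of_one_le_right hc00.le h1) (by positivity)
    calc T = T / (c' ^ 2 / (ρ ^ 2 * β)) ^ (2 / β) * (c' ^ 2 / (ρ ^ 2 * β)) ^ (2 / β) :=
          (div_mul_cancel₀ _ (Real.rpow_pos_of_pos hc00 _).ne').symm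
      _ ≤ _ := by gcongr
  have htc : c' ≤ tₒ := by linarith
  have htκ : 2 * c' * a - 1 ≤ tₒ := by linarith
  have htS : S ≤ tₒ := by linarith
  have ht0 : 0 < tₒ := by linarith
  have hεξ : ε ≤ ξ / 4 := by
    have hk1 : (1 : ℝ) ≤ k := by exact_mod_cast hk
    have h1 : 0 < Real.log (2 * k / ξ) := Real.log_pos (by
      rw [one_lt_div hξ0]
      linarith)
    have h2 : (0 : ℝ) < mₒ := lt_trans (div_pos h1 (hcl.pMin_pos hk)) hlog
    have h3 : (1 : ℝ) ≤ mₒ := by exact_mod_cast h2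
    have h4 := h3.trans hexp.le
    rw [hε, Real.exp_neg, ← one_div, div_div, div_le_iff₀ (by positivity)]
    linarith
  have hδ1 : δ < 1 := hδ.trans_lt (Real.exp_lt_one_iff.2 (by norm_num))
  have hpp : 0 < (1 - δ) * (1 - ξ) := mul_pos (by linarith) (by linarith)
  -- The recursion constant divided by the lower bound on the probability of `G`.
  refine ⟨(b * tₒ + c' ^ 2 * Q / (2 * c' * a - 1)) / ((1 - δ) * (1 - ξ)), ?_⟩
  intro seed I hseed hI Ω _ P _ Z hZ t ht
  have hXne : Nonempty X := by
    obtain ⟨x, hx⟩ := hcl.1 ⟨0, hk⟩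
    exact ⟨⟨x, hcl.subset _ hx⟩⟩
  have hcon : KMeans.ContractsNear X A m I a b Q := fun η h0 h1 C hC => hQ I hI η h0 h1 C hC
  set G := KMeans.trajectory seed I c' tₒ Z ⁻¹' KMeans.confined A b t with hG
  have hGm : MeasurableSet G :=
    KMeans.measurable_trajectory hZ (KMeans.measurableSet_confined A b t)
  -- Seeding loses at most `3 * ξ / 4` and leaving the neighbourhood at most `ε ≤ ξ / 4`.
  have hPG : 1 - ξ ≤ P.real G := by
    have h1 := hw.real_seed_le hcl hk hB1.ratio_lt_f hξ0 hlog hexp hZ Sum.inl_injective hseed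
    have h2 : {ω | KMeans.centroidDist (seed fun i => (Z (Sum.inl i) ω : KMeans.Pt d)) A ≤
        f / 4 * Φ} ⊆ KMeans.trajectory seed I c' tₒ Z ⁻¹' KMeans.confined A b 0 := fun ω hω => by
      have h3 : KMeans.centroidDist (KMeans.trajectory seed I c' tₒ Z ω 0) A ≤ b / 2 :=
        (show _ ≤ f / 4 * Φ from hω).trans_eq (by rw [hb]; ring)
      refine ⟨h3, fun i hi => ?_⟩
      rw [Nat.le_zero.1 hi]
      linarith
    have h4 := h1.trans (measureReal_mono h2)
    have h5 := hcon.real_confined_zero_sub_le (seed := seed) hZ ha0.le hb0.le hQ0.le hc0.le htc ht0 t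
    have h6 : (b * Q + Q ^ 2) * c' ^ 2 * (1 / tₒ) ≤ b ^ 2 / 4 * ε := by
      rw [mul_one_div, div_le_iff₀ ht0]
      rw [hS, div_le_iff₀ (by positivity)] at htS
      linarith
    have h7 := le_of_mul_le_mul_left (h5.trans h6) (by positivity)
    linarith
  have hPG' : (1 - δ) * (1 - ξ) ≤ P.real G := le_trans (by nlinarith) hPG
  have hPG0 : 0 < P.real G := hpp.trans_le hPG'
  have hprob : IsProbabilityMeasure P[|G] := cond_isProbabilityMeasure fun h0 => by
    rw [measureReal_def, h0] at hPG0
    simp at hPG0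
  have hcost := KMeans.integrable_trajectory (seed := seed) (I := I) (c' := c') (tₒ := tₒ) hZ
    (fun C => KMeans.cost X C) t P[|G]
  have hdist := KMeans.integrable_trajectory (seed := seed) (I := I) (c' := c') (tₒ := tₒ) hZ
    (fun C => KMeans.centroidDist C A) t P[|G]
  refine ⟨G, ⟨_, KMeans.measurableSet_confined A b t, rfl⟩, hGm, hPG', hcost, hdist, ?_, ?_⟩
  · have h1 := integral_mono (hcost.sub (integrable_const (KMeans.clusterCost A))) hdist
      fun ω => hcl.cost_sub_clusterCost_le (KMeans.trajectory seed I c' tₒ Z ω t)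
    simp only [Pi.sub_apply] at h1
    rwa [integral_sub hcost (integrable_const _), integral_const, probReal_univ, one_smul] at h1
  · have ht1 : (0 : ℝ) < t := by exact_mod_cast ht
    have h1 := hcon.setIntegral_le (seed := seed) hZ hb0.le hQ0.le hc0.le hca htc htκ t
    have hM0 : 0 ≤ b * tₒ + c' ^ 2 * Q / (2 * c' * a - 1) := by
      have : 0 < 2 * c' * a - 1 := by linarith
      positivity
    rw [KMeans.integral_cond_eq]
    calc (P.real G)⁻¹ * ∫ ω in G, KMeans.centroidDist (KMeans.trajectory seed I c' tₒ Z ω t) A ∂P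
        ≤ (P.real G)⁻¹ * ((b * tₒ + c' ^ 2 * Q / (2 * c' * a - 1)) / (t + tₒ)) := by gcongr
      _ ≤ ((1 - δ) * (1 - ξ))⁻¹ * ((b * tₒ + c' ^ 2 * Q / (2 * c' * a - 1)) / t) := by
          gcongr
          linarith
      _ = _ := by
          rw [inv_mul_eq_div, div_right_comm]
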